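/- Let $X$ be a complex Banach space and, for $R>0$, let $\mathcal B_R=\{x\in X:\|x\|<R\}$ and $\mathcal B=\mathcal B_1$. Let $h:\mathcal B\to X$ be holomorphic (that is, complex Fréchet differentiable) with $h(0)=0$ and $h'(0)=-I$. Assume that $h$ is a semi-complete vector field on $\mathcal B$, in the sense that for every $x_0\in\mathcal B$ the Cauchy problem $x'(t)=h(x(t))$, $x(0)=x_0$, has a solution defined on all of $[0,\infty)$ with values in $\mathcal B$. Let $r\in(0,1)$ and put $\Omega=\Omega_1\cup\Omega_2$, where $$\Omega_1=\Bigl\{\lambda\in\mathbb C:\ |\lambda|<\tfrac12\,\tfrac{1-r}{1+r}\Bigr\},\qquad \Omega_2=\Bigl\{\lambda\in\mathbb C:\ \lambda\neq0,\ |\arg\lambda|<\arcsin\tfrac{1-r^2}{1+r^2}\Bigr\}$$ with $\arg$ the principal argument in $(-\pi,\pi]$. Then for each $\lambda\in\Omega$ the nonlinear resolvent $(\lambda I-h)^{-1}$ with values in $\mathcal B_r$ exists on a neighbourhood of $\lambda\mathcal B_r$: there is an open set $V_\lambda\subseteq X$ with $-h(0)=0\in V_\lambda$ and $\lambda\mathcal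 B_r\subseteq V_\lambda$ such that for every $z\in V_\lambda$ the equation $\lambda x-h(x)=z$ has exactly one solution $x=(\lambda I-h)^{-1}(z)$ in $\mathcal B_r$, and $(\lambda I-h)^{-1}:V_\lambda\to\mathcal B_r$ is holomorphic. Consequently, the associated resolvent mapping $\Phi_\lambda=(\lambda I-h)^{-1}\circ(\lambda I)$, which sends $y\in\mathcal B_r$ to the unique solution $x\in\mathcal B_r$ of $\lambda x-h(x)=\lambda y$, is a self-mapping of $\mathcal B_r$. Moreover, the mapping $(\lambda,y)\mapsto\Phi_\lambda(y)$ is holomorphic on $\Omega\times\mathcal B_r$. -/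

import Mathlib

open Set Metric

/-- `h` is a semi-complete vector field on `D`: for every initial value `x₀ ∈ D` the Cauchy problem
`x'(t) = h (x t)`, `x 0 = x₀` has a solution on all of `[0, ∞)` with values in `D`
(at `t = 0` the derivative is one-sided). -/
def IsSemiComplete {X : Type*} [NormedAddCommGroup X] [NormedSpace ℂ X]
    (h : X → X) (D : Set X) : Prop :=
  ∀ x₀ ∈ D, ∃ x : ℝ → X, x 0 = x₀ ∧
    ∀ t : ℝ, 0 ≤ t → x t ∈ D ∧ HasDerivWithinAt x (h (x t)) (Ici 0) t

/-- The nonlinear resolvent `(μ I - h)⁻¹`: the inverse of the restriction of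
`x ↦ μ x - h x` to `D`. It is meaningful at the points that have exactly one preimage in `D`;
see `ResolventExistsOn`. -/
noncomputable def nonlinearResolvent {X : Type*} [NormedAddCommGroup X] [NormedSpace ℂ X]
    (h : X → X) (D : Set X) (μ : ℂ) : X → X :=
  Function.invFunOn (fun x => μ • x - h x) D

/-- `(μ I - h)⁻¹` exists on `V` with values in `D`: `V` is an open set containing `-h(0)`, every
`z ∈ V` has exactly one preimage in `D` under `μ I - h`, and the inverse so defined on `V` is
holomorphic. -/
def ResolventExistsOn {X : Type*} [NormedAddCommGroup X] [NormedSpace ℂ X]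
    (h : X → X) (D : Set X) (μ : ℂ) (V : Set X) : Prop :=
  IsOpen V ∧ -h 0 ∈ V ∧ (∀ z ∈ V, ∃! x : X, x ∈ D ∧ μ • x - h x = z) ∧
    DifferentiableOn ℂ (nonlinearResolvent h D μ) V

/-- The associated resolvent mapping `Φ_μ = (μ I - h)⁻¹ ∘ (μ I)`. -/
noncomputable def associatedResolvent {X : Type*} [NormedAddCommGroup X] [NormedSpace ℂ X]
    (h : X → X) (D : Set X) (μ : ℂ) (y : X) : X :=
  nonlinearResolvent h D μ (μ • y)

/-- The disc `|μ| < (1/2) (1 - r) / (1 + r)`. -/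
def keyDisc (r : ℝ) : Set ℂ :=
  {μ | ‖μ‖ < 1 / 2 * ((1 - r) / (1 + r))}

/-- The sector `μ ≠ 0`, `|arg μ| < arcsin ((1 - r²) / (1 + r²))`. -/
def keySector (r : ℝ) : Set ℂ :=
  {μ | μ ≠ 0 ∧ |Complex.arg μ| < Real.arcsin ((1 - r ^ 2) / (1 + r ^ 2))}

/-- The domain `Ω`, the union of the disc and the sector. -/
def keyDomain (r : ℝ) : Set ℂ :=
  keyDisc r ∪ keySector r

/-! Let `s` be slightly larger than `r`, and let `ℓ` be a support functional at `y`, `0 < ‖y‖ < s`.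
The flow of `h` consists of holomorphic self-maps of the ball fixing 0, so it does not increase the
norm (Schwarz), and differentiating at time 0 gives `Re ℓ (h y) ≤ 0`
(`IsSemiComplete.isDissipativeOn`). With `u = y / ‖y‖`, the function `-ℓ (h (ζ u)) / ζ` therefore
has nonnegative real part, and its value at 0 is 1. The Schwarz lemma puts `ℓ (h y) / ‖y‖` in the
disc of centre `-C` and radius `R`, where `C = (1 + s²) / (1 - s²)` and `R = 2s / (1 - s²)`. After
multiplication by the unimodular constant that makes `μ + C` positive, the field `z + h y - μ y` has
real part at most `‖z‖ - (|μ + C| - R) ‖y‖` on `ℓ`. It points inwards on the sphere of radius `r` as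
soon as `‖z‖ < (|μ + C| - R) r`. This covers all `z = μ y` with `‖y‖ < r` if `|μ| < |μ + C| - R`,
which holds on `Ω` for `s` close to `r`.

A bounded inward holomorphic field has exactly one zero, because a small Euler step maps the ball
strictly inside itself and the Earle–Hamilton theorem applies
(`exists_unique_zero_differentiableOn`). In infinite dimensions a holomorphic `h` need not be
bounded on smaller balls. `IsSemiComplete.exists_norm_le` obtains this from the difference quotients
of the flow: they are bounded, with numerical ranges bounded uniformly in time, and the numerical
range alone controls the norm (`norm_le_of_numericalRange_le`). -/

/-! ### Bounded Gateaux holomorphic maps are Fréchet holomorphic. -/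

section LineDifferentiable

variable {E F : Type*} [NormedAddCommGroup E] [NormedSpace ℂ E] [NormedAddCommGroup F]
  [NormedSpace ℂ F]

open Filter Topology Asymptotics

theorem differentiableAt_slice {f : E → F} {x v : E} {ζ : ℂ}
    (hf : LineDifferentiableAt ℂ f (x + ζ • v) v) :
    DifferentiableAt ℂ (fun ξ : ℂ => f (x + ξ • v)) ζ := by
  have h1 : DifferentiableAt ℂ (fun ξ : ℂ => f (x + ζ • v + ξ • v)) (ζ - ζ) := by
    rw [sub_self]; exact hf
  have h2 := DifferentiableAt.comp ζ (f := fun ξ : ℂ => ξ - ζ) h1 (by fun_prop)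
  refine h2.congr_of_eventuallyEq (Eventually.of_forall fun ξ => ?_)
  simp only [Function.comp_apply]
  congr 1
  module

theorem add_smul_mem_ball {x w : E} {R : ℝ} (hw : w ≠ 0) {ζ : ℂ}
    (hζ : ζ ∈ ball (0 : ℂ) (R / ‖w‖)) : x + ζ • w ∈ ball x R := by
  rw [mem_ball_zero_iff, lt_div_iff₀ (norm_pos_iff.2 hw)] at hζ
  simpa [mem_ball_iff_norm, norm_smul] using hζ

/-- Schwarz lemma for `ξ ↦ f (x + ξ w)` on the disc of radius `R / ‖w‖`, evaluated at `ξ = 1`. -/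
theorem norm_add_sub_le_of_lineDifferentiable {f : E → F} {x w : E} {R M : ℝ}
    (hl : ∀ y ∈ ball x R, ∀ v, LineDifferentiableAt ℂ f y v)
    (hb : ∀ y ∈ ball x R, ‖f y‖ ≤ M) (hw : ‖w‖ < R) :
    ‖f (x + w) - f x‖ ≤ 2 * M / R * ‖w‖ := by
  rcases eq_or_ne w 0 with rfl | h0
  · simp
  have hpos := norm_pos_iff.2 h0
  have hR : 0 < R := hpos.trans hw
  have key := Complex.dist_le_div_mul_dist_of_mapsTo_ball (f := fun ξ : ℂ => f (x + ξ • w))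
    (c := 0) (z := 1) (R₁ := R / ‖w‖) (R₂ := 2 * M)
    (fun ζ hζ => (differentiableAt_slice
      (hl _ (add_smul_mem_ball h0 hζ) w)).differentiableWithinAt)
    (fun ζ hζ => ?_) ?_
  · simp only [dist_eq_norm, one_smul, zero_smul, add_zero, sub_zero, norm_one, mul_one] at key
    refine key.trans_eq ?_
    field_simp
  · rw [mem_closedBall, dist_eq_norm, zero_smul, add_zero]
    have h1 := hb _ (add_smul_mem_ball h0 hζ)
    have h2 := hb x (mem_ball_self hR)
    linarith [norm_sub_le (f (x + ζ • w)) (f x)]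
  · rw [mem_ball_zero_iff, norm_one, one_lt_div hpos]; exact hw

/-- Once its linear part is removed, the slice vanishes to second order at 0, so the Schwarz lemma
gains a square. -/
theorem norm_add_sub_sub_lineDeriv_le {f : E → F} {x w : E} {R M : ℝ}
    (hl : ∀ y ∈ ball x R, ∀ v, LineDifferentiableAt ℂ f y v)
    (hb : ∀ y ∈ ball x R, ‖f y‖ ≤ M) (hw : ‖w‖ < R) :
    ‖f (x + w) - f x - lineDeriv ℂ f x w‖ ≤ 4 * M / R ^ 2 * ‖w‖ ^ 2 ∧
      ‖lineDeriv ℂ f x w‖ ≤ 2 * M / R * ‖w‖ := by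
  rcases eq_or_ne w 0 with rfl | h0
  · simp [lineDeriv_zero]
  have hpos := norm_pos_iff.2 h0
  have hR : 0 < R := hpos.trans hw
  have hdiff : DifferentiableOn ℂ (fun ξ : ℂ => f (x + ξ • w)) (ball 0 (R / ‖w‖)) :=
    fun ζ hζ => (differentiableAt_slice
      (hl _ (add_smul_mem_ball h0 hζ) w)).differentiableWithinAt
  have hmap : ∀ ζ ∈ ball (0 : ℂ) (R / ‖w‖), ‖f (x + ζ • w) - f x‖ ≤ 2 * M := by
    intro ζ hζ
    have h1 := hb _ (add_smul_mem_ball h0 hζ)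
    have h2 := hb x (mem_ball_self hR)
    linarith [norm_sub_le (f (x + ζ • w)) (f x)]
  have hder : ‖lineDeriv ℂ f x w‖ ≤ 2 * M / R * ‖w‖ := by
    have := Complex.norm_deriv_le_div_of_mapsTo_ball (R₂ := 2 * M) hdiff
      (fun ζ hζ => by simpa [dist_eq_norm] using hmap ζ hζ) (by positivity)
    refine this.trans_eq ?_
    field_simp
  refine ⟨?_, hder⟩
  have hlin : HasDerivAt (fun ξ : ℂ => f (x + ξ • w)) (lineDeriv ℂ f x w) 0 :=
    (hl x (mem_ball_self hR) w).hasLineDerivAt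
  have key := Complex.dist_le_mul_div_pow_of_mapsTo_ball_of_isLittleO (n := 1)
    (f := fun ξ : ℂ => f (x + ξ • w) - ξ • lineDeriv ℂ f x w)
    (c := 0) (z := 1) (R₁ := R / ‖w‖) (R₂ := 4 * M)
    (hdiff.sub (by fun_prop)) (fun ζ hζ => ?_) ?_ ?_
  · simp only [dist_eq_norm, one_smul, zero_smul, add_zero, sub_zero, norm_one] at key
    rw [sub_right_comm]
    refine key.trans_eq ?_
    rw [one_div_div, div_pow]
    ring
  · rw [mem_closedBall, dist_eq_norm, zero_smul, add_zero, zero_smul, sub_zero, sub_right_comm]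
    refine (norm_sub_le _ _).trans ?_
    have h1 := hmap ζ hζ
    have h2 : ‖ζ • lineDeriv ℂ f x w‖ ≤ 2 * M := by
      rw [norm_smul]
      have h3 : ‖ζ‖ ≤ R / ‖w‖ := (mem_ball_zero_iff.1 hζ).le
      calc ‖ζ‖ * ‖lineDeriv ℂ f x w‖ ≤ R / ‖w‖ * (2 * M / R * ‖w‖) := by gcongr
        _ = 2 * M := by field_simp
    linarith
  · have := hasDerivAt_iff_isLittleO.1 hlin
    simp only [sub_zero] at this
    simp only [sub_zero, pow_one]
    refine (this.norm_right).congr_left fun ξ => ?_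
    simp only [zero_smul, add_zero, sub_zero]
    abel
  · rw [mem_ball_zero_iff, norm_one, one_lt_div hpos]; exact hw

/-- The second difference of `f` in the directions `t v`, `t w` is `O(t²)`: the Lipschitz estimate
is applied to `f`, then to its increment along `t v`. -/
theorem lineDeriv_add_of_lineDifferentiable {f : E → F} {x : E} {R M : ℝ} (hR : 0 < R)
    (hl : ∀ y ∈ ball x (3 * R), ∀ v, LineDifferentiableAt ℂ f y v)
    (hb : ∀ y ∈ ball x (3 * R), ‖f y‖ ≤ M) (v w : E) :
    lineDeriv ℂ f x (v + w) = lineDeriv ℂ f x v + lineDeriv ℂ f x w := by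
  have hM : 0 ≤ M := (norm_nonneg _).trans (hb x (mem_ball_self (by positivity)))
  have hx : x ∈ ball x (3 * R) := mem_ball_self (by positivity)
  have hs := fun v => (hasLineDerivAt_iff_tendsto_slope_zero.1 (hl x hx v).hasLineDerivAt)
  have hlim := ((hs (v + w)).sub (hs v)).sub (hs w)
  have hzero : Tendsto (fun t : ℂ => t⁻¹ • (f (x + t • (v + w)) - f x) -
      t⁻¹ • (f (x + t • v) - f x) - t⁻¹ • (f (x + t • w) - f x)) (𝓝[≠] 0) (𝓝 0) := by
    set C := 2 * (2 * M / R * ‖v‖) / R * ‖w‖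
    refine squeeze_zero_norm' (a := fun t : ℂ => C * ‖t‖) ?_ ?_
    · have hv : ∀ᶠ t : ℂ in 𝓝[≠] 0, ‖t • v‖ < R := by
        refine nhdsWithin_le_nhds ?_
        exact ContinuousAt.eventually_lt (by fun_prop) (by fun_prop) (by simpa)
      have hw : ∀ᶠ t : ℂ in 𝓝[≠] 0, ‖t • w‖ < R := by
        refine nhdsWithin_le_nhds ?_
        exact ContinuousAt.eventually_lt (by fun_prop) (by fun_prop) (by simpa)
      filter_upwards [hv, hw, self_mem_nhdsWithin] with t htv htw ht0
      have ht : t ≠ 0 := ht0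
      have htp := norm_pos_iff.2 ht
      have key := norm_add_sub_le_of_lineDifferentiable (f := fun y => f (y + t • v) - f y)
        (x := x) (w := t • w) (R := R) (M := 2 * M / R * ‖t • v‖) ?_ ?_ htw
      · have e : t⁻¹ • (f (x + t • (v + w)) - f x) -
          t⁻¹ • (f (x + t • v) - f x) - t⁻¹ • (f (x + t • w) - f x) =
          t⁻¹ • (f (x + t • w + t • v) - f (x + t • w) - (f (x + t • v) - f x)) := by
          rw [show x + t • (v + w) = x + t • w + t • v by module]
          module
        rw [e, norm_smul, norm_inv]
        refine (mul_le_mul_of_nonneg_left key (by positivity)).trans_eq ?_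
        rw [norm_smul, norm_smul]
        field_simp
        simp only [C]
        field_simp
      · intro y hy u
        rw [mem_ball, dist_eq_norm] at hy
        have h1 : LineDifferentiableAt ℂ f (y + t • v) u := by
          refine hl _ ?_ u
          rw [mem_ball, dist_eq_norm, add_sub_right_comm]
          linarith [norm_add_le (y - x) (t • v)]
        have h2 : LineDifferentiableAt ℂ f y u := hl _ (by rw [mem_ball, dist_eq_norm]; linarith) u
        have h3 : DifferentiableAt ℂ (fun s : ℂ => f (y + t • v + s • u)) 0 := h1
        have h4 : DifferentiableAt ℂ (fun s : ℂ => f (y + s • u)) 0 := h2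
        refine (h3.sub h4).congr_of_eventuallyEq (Eventually.of_forall fun s => ?_)
        simp only [Pi.sub_apply]
        congr 2
        abel
      · intro y hy
        rw [mem_ball, dist_eq_norm] at hy
        have hsub : ball y R ⊆ ball x (3 * R) := by
          refine ball_subset_ball' ?_
          rw [dist_eq_norm]; linarith
        exact norm_add_sub_le_of_lineDifferentiable (fun z hz => hl z (hsub hz))
          (fun z hz => hb z (hsub hz)) htv
    · refine (Continuous.tendsto' (by fun_prop) 0 0 (by simp)).mono_left nhdsWithin_le_nhds
  have := tendsto_nhds_unique hlim hzero
  rw [sub_sub, sub_eq_zero] at this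
  exact this

/-- A bounded function on an open set which is holomorphic along complex lines is holomorphic. -/
theorem differentiableOn_of_lineDifferentiable {f : E → F} {U : Set E} (hU : IsOpen U) {M : ℝ}
    (hl : ∀ y ∈ U, ∀ v, LineDifferentiableAt ℂ f y v) (hb : ∀ y ∈ U, ‖f y‖ ≤ M) :
    DifferentiableOn ℂ f U := by
  intro x hx
  obtain ⟨R', hR', hsub⟩ := Metric.isOpen_iff.1 hU x hx
  obtain ⟨R, hR, rfl⟩ : ∃ R, 0 < R ∧ R' = 3 * R := ⟨R' / 3, by positivity, by ring⟩
  have hsub2 : ball x R ⊆ U := (ball_subset_ball (by linarith)).trans hsub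
  have hM : 0 ≤ M := (norm_nonneg _).trans (hb x hx)
  have hT := fun w hw => norm_add_sub_sub_lineDeriv_le (w := w) (fun y hy => hl y (hsub2 hy))
    (fun y hy => hb y (hsub2 hy)) hw
  let A₀ : E →ₗ[ℂ] F :=
    { toFun := lineDeriv ℂ f x
      map_add' := lineDeriv_add_of_lineDifferentiable hR (fun y hy => hl y (hsub hy))
        (fun y hy => hb y (hsub hy))
      map_smul' := fun c v => lineDeriv_smul }
  let A : E →L[ℂ] F := A₀.mkContinuous (2 * M / R) (by
    intro w
    obtain ⟨c, hc0, hc⟩ : ∃ c : ℂ, c ≠ 0 ∧ ‖c • w‖ < R := by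
      refine ⟨((R / (‖w‖ + 1) : ℝ) : ℂ), ?_, ?_⟩
      · norm_cast; positivity
      · rw [norm_smul, Complex.norm_real, Real.norm_of_nonneg (by positivity), div_mul_eq_mul_div,
          div_lt_iff₀ (by positivity)]
        nlinarith
    have h1 := (hT (c • w) hc).2
    have h2 : lineDeriv ℂ f x (c • w) = c • A₀ w := A₀.map_smul c w
    rw [h2, norm_smul, norm_smul] at h1
    have := norm_pos_iff.2 hc0
    refine le_of_mul_le_mul_left ?_ this
    linarith)
  have : HasFDerivAt f A x := by
    rw [hasFDerivAt_iff_isLittleO_nhds_zero]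
    have hO : (fun w => f (x + w) - f x - A w) =O[𝓝 0] fun w => ‖w‖ ^ 2 := by
      refine IsBigO.of_bound (4 * M / R ^ 2) ?_
      filter_upwards [ball_mem_nhds (0 : E) hR] with w hw
      rw [Real.norm_of_nonneg (by positivity)]
      exact (hT w (mem_ball_zero_iff.1 hw)).1
    exact hO.trans_isLittleO (isLittleO_norm_pow_id one_lt_two)
  exact this.differentiableAt.differentiableWithinAt

end LineDifferentiable

/-! ### Schwarz lemma in the right half-plane -/

section Caratheodory

open ComplexConjugate

theorem sq_norm_sub_le_sq_norm_add_conj {z a : ℂ} (hz : 0 ≤ z.re) (ha : 0 < a.re) :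
    ‖z - a‖ ^ 2 ≤ ‖z + conj a‖ ^ 2 ∧ z + conj a ≠ 0 := by
  constructor
  · rw [Complex.sq_norm, Complex.sq_norm, Complex.normSq_apply, Complex.normSq_apply]
    simp only [Complex.sub_re, Complex.sub_im, Complex.add_re, Complex.add_im, Complex.conj_re,
      Complex.conj_im]
    nlinarith [mul_nonneg hz ha.le]
  · intro h
    have := congrArg Complex.re h
    simp only [Complex.add_re, Complex.conj_re, Complex.zero_re] at this
    linarith

/-- The Schwarz lemma for holomorphic functions on the disc with nonnegative real part. -/
theorem norm_sub_le_of_re_nonneg {g : ℂ → ℂ} (hg : DifferentiableOn ℂ g (ball 0 1))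
    (hre : ∀ ζ ∈ ball (0 : ℂ) 1, 0 ≤ (g ζ).re) (h0 : 0 < (g 0).re) {ζ : ℂ}
    (hζ : ζ ∈ ball (0 : ℂ) 1) : ‖g ζ - g 0‖ ≤ ‖ζ‖ * ‖g ζ + conj (g 0)‖ := by
  have hne : ∀ ζ ∈ ball (0 : ℂ) 1, g ζ + conj (g 0) ≠ 0 := fun ζ hζ =>
    (sq_norm_sub_le_sq_norm_add_conj (hre ζ hζ) h0).2
  -- The Cayley transform sends the half-plane to the unit disc and `g 0` to 0.
  have key := Complex.norm_le_norm_of_mapsTo_ball (R := 1) (z := ζ)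
    (f := fun ξ => (g ξ - g 0) / (g ξ + conj (g 0)))
    ((hg.sub_const _).div (hg.add_const _) hne) (fun ξ hξ => ?_) (by simp)
    (mem_ball_zero_iff.1 hζ)
  · rwa [norm_div, div_le_iff₀ (norm_pos_iff.2 (hne ζ hζ))] at key
  · rw [mem_closedBall_zero_iff, norm_div, div_le_one (norm_pos_iff.2 (hne ξ hξ))]
    exact le_of_sq_le_sq (sq_norm_sub_le_sq_norm_add_conj (hre ξ hξ) h0).1 (norm_nonneg _)

end Caratheodory

/-! ### Earle–Hamilton theorem and zeros of inward-pointing fields -/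

section FixedPoint

open Filter Topology Asymptotics

variable {X : Type*} [NormedAddCommGroup X] [NormedSpace ℂ X]

theorem DifferentiableOn.lineDifferentiableAt_of_isOpen {E F : Type*} [NormedAddCommGroup E]
    [NormedSpace ℂ E] [NormedAddCommGroup F] [NormedSpace ℂ F] {f : E → F} {U : Set E}
    (hf : DifferentiableOn ℂ f U) (hU : IsOpen U) {x : E} (hx : x ∈ U) (v : E) :
    LineDifferentiableAt ℂ f x v :=
  (hf.differentiableAt (hU.mem_nhds hx)).lineDifferentiableAt

theorem norm_sub_le_of_bounded_differentiableOn {Y : Type*} [NormedAddCommGroup Y]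
    [NormedSpace ℂ Y] {f : X → Y} {c : X} {r s M : ℝ} (hrs : r < s)
    (hf : DifferentiableOn ℂ f (ball c s)) (hM : ∀ x ∈ ball c s, ‖f x‖ ≤ M) {x y : X}
    (hx : x ∈ ball c r) (hy : y ∈ ball c r) :
    ‖f x - f y‖ ≤ 2 * M / (s - r) * ‖x - y‖ := by
  have hpos : 0 < s - r := sub_pos.2 hrs
  have hsub : ball y (s - r) ⊆ ball c s := ball_subset_ball' (by
    have := mem_ball.1 hy
    linarith)
  rcases lt_or_ge ‖x - y‖ (s - r) with h | h
  · have := norm_add_sub_le_of_lineDifferentiable (w := x - y)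
      (fun z hz v => hf.lineDifferentiableAt_of_isOpen isOpen_ball (hsub hz) v)
      (fun z hz => hM z (hsub hz)) h
    rwa [add_sub_cancel] at this
  · have h1 := hM x (ball_subset_ball hrs.le hx)
    have h2 := hM y (ball_subset_ball hrs.le hy)
    have hM0 := (norm_nonneg _).trans h1
    calc ‖f x - f y‖ ≤ 2 * M := by linarith [norm_sub_le (f x) (f y)]
      _ = 2 * M / (s - r) * (s - r) := by field_simp
      _ ≤ _ := by gcongr

/-- The Earle–Hamilton contraction estimate for a ball. -/
theorem norm_iterate_sub_iterate_le {T : X → X} {r r' : ℝ} (hr' : 0 < r') (hr : r' < r)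
    (hT : DifferentiableOn ℂ T (ball 0 r)) (hm : ∀ x ∈ ball (0 : X) r, ‖T x‖ ≤ r') {p q : X}
    (hp : p ∈ ball (0 : X) r) (hq : q ∈ ball (0 : X) r) (n : ℕ) :
    ‖T^[n] p - T^[n] q‖ ≤ 2 * r * (r' / r) ^ n := by
  have hr0 : 0 < r := hr'.trans hr
  -- Complexify: `ζ T` still preserves the ball for `|ζ| < r / r'`. The difference of the `n`-th
  -- iterates vanishes to order `n` at `ζ = 0`, so the Schwarz lemma at `ζ = 1` yields the geometric
  -- factor.
  let S : ℕ → X → ℂ → X := fun n p ζ => (fun x => ζ • T x)^[n] p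
  have hS : ∀ n p ζ, S (n + 1) p ζ = ζ • T (S n p ζ) := fun n p ζ =>
    Function.iterate_succ_apply' _ _ _
  have hmem : ∀ p ∈ ball (0 : X) r, ∀ n, ∀ ζ ∈ ball (0 : ℂ) (r / r'), S n p ζ ∈ ball 0 r := by
    intro p hp n ζ hζ
    induction n with
    | zero => exact hp
    | succ n ih =>
      rw [mem_ball_zero_iff, lt_div_iff₀ hr'] at hζ
      rw [hS, mem_ball_zero_iff, norm_smul]
      exact (mul_le_mul_of_nonneg_left (hm _ ih) (norm_nonneg _)).trans_lt hζ
  have hdiff : ∀ p ∈ ball (0 : X) r, ∀ n, DifferentiableOn ℂ (S n p) (ball 0 (r / r')) := by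
    intro p hp n
    induction n with
    | zero => exact differentiableOn_const p
    | succ n ih =>
      rw [show S (n + 1) p = fun ζ => ζ • T (S n p ζ) from funext (hS n p)]
      exact differentiableOn_id.smul (hT.comp ih (hmem p hp n))
  have hpos : 0 < r / r' := by positivity
  have hO : ∀ n, (fun ζ => S n p ζ - S n q ζ) =O[𝓝 0] fun ζ : ℂ => ‖ζ‖ ^ n := by
    intro n
    induction n with
    | zero =>
      simp only [S, Function.iterate_zero, id_eq, pow_zero]
      exact isBigO_const_const (p - q) (one_ne_zero (α := ℝ)) _
    | succ n ih =>
      have h1 : (fun ζ => T (S n p ζ) - T (S n q ζ)) =O[𝓝 0] fun ζ : ℂ => ‖ζ‖ ^ n := by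
        -- The starting points `p`, `q` may lie near the sphere, but later iterates tend to 0 with
        -- `ζ`, where `T` is Lipschitz.
        cases n with
        | zero =>
          simp only [S, Function.iterate_zero, id_eq, pow_zero]
          exact isBigO_const_const (T p - T q) (one_ne_zero (α := ℝ)) _
        | succ n =>
          refine (IsBigO.of_bound (2 * r' / (r - r / 2)) ?_).trans ih
          have h2 : ∀ p ∈ ball (0 : X) r, ∀ᶠ ζ : ℂ in 𝓝 0, S (n + 1) p ζ ∈ ball (0 : X) (r / 2) := by
            intro p hp
            have hc := ((hdiff p hp (n + 1)).continuousOn.continuousAt (ball_mem_nhds _ hpos))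
            refine hc.eventually_mem (isOpen_ball.mem_nhds ?_)
            rw [hS, zero_smul]
            exact mem_ball_self (by positivity)
          filter_upwards [h2 p hp, h2 q hq] with ζ h3 h4
          exact norm_sub_le_of_bounded_differentiableOn (by linarith) hT hm h3 h4
      have h2 := (isBigO_refl (fun ζ : ℂ => ζ) (𝓝 0)).norm_right.smul h1
      refine h2.congr (fun ζ => ?_) (fun ζ => ?_)
      · simp only [hS, smul_sub]
      · rw [smul_eq_mul, pow_succ']
  cases n with
  | zero =>
    have := norm_sub_le p q
    rw [mem_ball_zero_iff] at hp hq
    simp only [Function.iterate_zero, id_eq, pow_zero, mul_one]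
    linarith
  | succ n =>
    have h0 : S (n + 1) p 0 - S (n + 1) q 0 = 0 := by simp [hS]
    have key := Complex.dist_le_mul_div_pow_of_mapsTo_ball_of_isLittleO (n := n)
      (f := fun ζ => S (n + 1) p ζ - S (n + 1) q ζ) (c := 0) (z := 1) (R₁ := r / r')
      (R₂ := 2 * r) ((hdiff p hp _).sub (hdiff q hq _)) (fun ζ hζ => ?_) ?_ ?_
    · simp only [h0, dist_zero_right, norm_one, one_div_div, S, one_smul] at key
      exact key
    · rw [h0, mem_closedBall_zero_iff]
      have h1 := mem_ball_zero_iff.1 (hmem p hp (n + 1) ζ hζ)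
      have h2 := mem_ball_zero_iff.1 (hmem q hq (n + 1) ζ hζ)
      linarith [norm_sub_le (S (n + 1) p ζ) (S (n + 1) q ζ)]
    · simp only [h0, sub_zero]
      refine (hO (n + 1)).trans_isLittleO ?_
      have := (isLittleO_pow_pow (𝕜 := ℝ) (Nat.lt_succ_self n)).comp_tendsto
        (tendsto_norm_zero (E := ℂ))
      exact this
    · rw [mem_ball_zero_iff, norm_one, one_lt_div hr']; exact hr

/-- The Earle–Hamilton theorem for a ball. -/
theorem exists_fixedPoint [CompleteSpace X] {T : X → X} {r r' : ℝ} (hr' : 0 < r') (hr : r' < r)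
    (hT : DifferentiableOn ℂ T (ball 0 r)) (hm : ∀ x ∈ ball (0 : X) r, ‖T x‖ ≤ r') :
    ∃ x ∈ ball (0 : X) r, T x = x ∧ (∀ y ∈ ball (0 : X) r, T y = y → y = x) ∧
      ∀ n, ‖T^[n] 0 - x‖ ≤ 2 * r * (r' / r) ^ n := by
  have hr0 : 0 < r := hr'.trans hr
  have h0 : (0 : X) ∈ ball (0 : X) r := mem_ball_self hr0
  have hsub : closedBall (0 : X) r' ⊆ ball 0 r := closedBall_subset_ball hr
  have hTm : ∀ x ∈ ball (0 : X) r, T x ∈ closedBall (0 : X) r' := fun x hx =>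
    mem_closedBall_zero_iff.2 (hm x hx)
  have hlt : r' / r < 1 := (div_lt_one hr0).2 hr
  have hpos : 0 ≤ r' / r := by positivity
  have hC : CauchySeq fun n => T^[n] 0 := by
    refine cauchySeq_of_le_geometric (r' / r) (2 * r) hlt fun n => ?_
    rw [dist_eq_norm, Function.iterate_succ_apply]
    exact norm_iterate_sub_iterate_le hr' hr hT hm h0 (hsub (hTm 0 h0)) n
  obtain ⟨x, hx⟩ := cauchySeq_tendsto_of_complete hC
  have hit : ∀ n, T^[n] 0 ∈ closedBall (0 : X) r' := by
    intro n
    cases n with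
    | zero => exact mem_closedBall_self hr'.le
    | succ n =>
      induction n with
      | zero => exact hTm _ h0
      | succ n ih => rw [Function.iterate_succ_apply']; exact hTm _ (hsub ih)
  have hxm : x ∈ ball (0 : X) r :=
    hsub (isClosed_closedBall.mem_of_tendsto hx (Eventually.of_forall hit))
  have hfix : T x = x := by
    have h1 := ((hT.continuousOn.continuousAt (isOpen_ball.mem_nhds hxm)).tendsto).comp hx
    have h2 := hx.comp (tendsto_add_atTop_nat 1)
    refine tendsto_nhds_unique h1 (h2.congr fun n => ?_)
    simp only [Function.comp_apply]
    exact Function.iterate_succ_apply' _ _ _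
  have hitfix : ∀ {y}, T y = y → ∀ n, T^[n] y = y := fun h n => Function.iterate_fixed h n
  refine ⟨x, hxm, hfix, fun y hy hTy => ?_, fun n => ?_⟩
  · have hlim : Tendsto (fun n => 2 * r * (r' / r) ^ n) atTop (𝓝 (2 * r * 0)) :=
      (tendsto_pow_atTop_nhds_zero_of_lt_one hpos hlt).const_mul _
    rw [mul_zero] at hlim
    have := ge_of_tendsto hlim (Eventually.of_forall fun n => by
      have := norm_iterate_sub_iterate_le hr' hr hT hm hy hxm n
      rwa [hitfix hTy, hitfix hfix] at this)
    exact sub_eq_zero.1 (norm_le_zero_iff.1 this)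
  · have := norm_iterate_sub_iterate_le hr' hr hT hm h0 hxm n
    rwa [hitfix hfix] at this

/-- An Euler step for a Lipschitz vector field with a bound on its numerical range. -/
theorem one_add_mul_norm_add_smul_le {F : X → X} {r s N L b c ε : ℝ}
    (hN : ∀ x ∈ ball (0 : X) s, ‖F x‖ ≤ N)
    (hL : ∀ x ∈ ball (0 : X) s, ∀ y ∈ ball (0 : X) s, ‖F x - F y‖ ≤ L * ‖x - y‖)
    (hF : ∀ y ∈ ball (0 : X) s, ∀ ℓ : StrongDual ℂ X, ‖ℓ‖ ≤ 1 → ℓ y = ‖y‖ →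
      (ℓ (F y)).re ≤ b - c * ‖y‖) (hL0 : 0 ≤ L) (hN0 : 0 ≤ N)
    (hε : 0 ≤ ε) (hεN : r + ε * N < s) {x : X} (hx : x ∈ ball (0 : X) r) :
    (1 + ε * c) * ‖x + (ε : ℂ) • F x‖ ≤ r + ε * (b + ε * (L * N)) := by
  set y := x + (ε : ℂ) • F x with hy
  have hxr := mem_ball_zero_iff.1 hx
  have hxs : x ∈ ball (0 : X) s := mem_ball_zero_iff.2 (by nlinarith)
  have hnorm : ‖(ε : ℂ) • F x‖ ≤ ε * N := by
    rw [norm_smul, Complex.norm_real, Real.norm_of_nonneg hε]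
    exact mul_le_mul_of_nonneg_left (hN x hxs) hε
  have hys : y ∈ ball (0 : X) s := mem_ball_zero_iff.2 (by
    linarith [norm_add_le x ((ε : ℂ) • F x)])
  -- The functional supports the endpoint `y`, not `x`, so that `-c ‖y‖` can be moved to the left
  -- side; replacing `F x` by `F y` costs `ε² L N`.
  obtain ⟨ℓ, hℓ, hℓy⟩ := exists_dual_vector'' ℂ y
  have h1 := hF y hys ℓ hℓ hℓy
  have hle : ∀ z, (ℓ z).re ≤ ‖z‖ := fun z => (Complex.re_le_norm _).trans
    ((ℓ.le_opNorm z).trans (mul_le_of_le_one_left (norm_nonneg _) hℓ))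
  have h2 : (ℓ (F x - F y)).re ≤ L * (ε * N) := by
    refine (hle _).trans ((hL x hxs y hys).trans (mul_le_mul_of_nonneg_left ?_ hL0))
    rw [hy, sub_add_cancel_left, norm_neg]
    exact hnorm
  have h3 : ‖y‖ = (ℓ x).re + ε * (ℓ (F y)).re + ε * (ℓ (F x - F y)).re := by
    have : (ℓ y).re = ‖y‖ := by rw [hℓy]; simp
    rw [← this, hy, map_add, map_smul, smul_eq_mul, Complex.add_re, Complex.re_ofReal_mul,
      map_sub, Complex.sub_re]
    ring
  have h4 := hle x
  nlinarith [mul_le_mul_of_nonneg_left h1 hε, mul_le_mul_of_nonneg_left h2 hε]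

/-- A bounded holomorphic family of vector fields pointing strictly inwards on the sphere of radius
`r` has a unique zero in the ball of radius `r`, which depends holomorphically on the parameter. -/
theorem exists_unique_zero_differentiableOn [CompleteSpace X] {P : Type*} [NormedAddCommGroup P]
    [NormedSpace ℂ P] {W : Set P} (hW : IsOpen W) {F : P → X → X} {r s N b c : ℝ} (hr : 0 < r)
    (hrs : r < s) (hc : 0 < c) (hb : b < c * r)
    (hd : DifferentiableOn ℂ (fun q : P × X => F q.1 q.2) (W ×ˢ ball 0 s))
    (hN : ∀ p ∈ W, ∀ x ∈ ball (0 : X) s, ‖F p x‖ ≤ N)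
    (hF : ∀ p ∈ W, ∀ y ∈ ball (0 : X) s, ∀ ℓ : StrongDual ℂ X, ‖ℓ‖ ≤ 1 → ℓ y = ‖y‖ →
      (ℓ (F p y)).re ≤ b - c * ‖y‖) :
    ∃ x : P → X, DifferentiableOn ℂ x W ∧ ∀ p ∈ W, x p ∈ ball (0 : X) r ∧ F p (x p) = 0 ∧
      ∀ y ∈ ball (0 : X) r, F p y = 0 → y = x p := by
  rcases W.eq_empty_or_nonempty with rfl | ⟨p₀, hp₀⟩
  · exact ⟨fun _ => 0, differentiableOn_const _, by simp⟩
  have hN0 : 0 ≤ N := (norm_nonneg _).trans (hN p₀ hp₀ 0 (mem_ball_self (hr.trans hrs)))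
  set s₁ := (r + s) / 2
  have hrs₁ : r < s₁ := by simp only [s₁]; linarith
  have hs₁ : s₁ < s := by simp only [s₁]; linarith
  set L := 2 * N / (s - s₁)
  have hL0 : 0 ≤ L := div_nonneg (by positivity) (sub_pos.2 hs₁).le
  obtain ⟨ε, hε, hε1, hε2⟩ : ∃ ε : ℝ, 0 < ε ∧ r + ε * N < s₁ ∧ b + ε * (L * N) < c * r := by
    have h1 : ∀ᶠ ε : ℝ in 𝓝[>] 0, r + ε * N < s₁ := nhdsWithin_le_nhds
      (ContinuousAt.eventually_lt (by fun_prop) (by fun_prop) (by simpa))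
    have h2 : ∀ᶠ ε : ℝ in 𝓝[>] 0, b + ε * (L * N) < c * r := nhdsWithin_le_nhds
      (ContinuousAt.eventually_lt (by fun_prop) (by fun_prop) (by simpa))
    obtain ⟨ε, ⟨h1, h2⟩, h3⟩ := ((h1.and h2).and self_mem_nhdsWithin).exists
    exact ⟨ε, h3, h1, h2⟩
  have hsub : ball (0 : X) s₁ ⊆ ball 0 s := ball_subset_ball hs₁.le
  have hsubr : ball (0 : X) r ⊆ ball 0 s := ball_subset_ball hrs.le
  have hFd : ∀ p ∈ W, DifferentiableOn ℂ (F p) (ball 0 s) := fun p hp =>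
    hd.comp (f := fun x => (p, x)) (by fun_prop) fun x hx => ⟨hp, hx⟩
  let T : P → X → X := fun p x => x + (ε : ℂ) • F p x
  have hTfix : ∀ p x, T p x = x ↔ F p x = 0 := fun p x => by
    simp [T, hε.ne']
  set k := (r + ε * (b + ε * (L * N))) / (1 + ε * c)
  have hpos : 0 < 1 + ε * c := by positivity
  have hTm : ∀ p ∈ W, ∀ x ∈ ball (0 : X) r, ‖T p x‖ ≤ k := by
    intro p hp x hx
    rw [le_div_iff₀' hpos]
    exact one_add_mul_norm_add_smul_le (fun x hx => hN p hp x (hsub hx))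
      (fun x hx y hy => norm_sub_le_of_bounded_differentiableOn hs₁ (hFd p hp) (hN p hp) hx hy)
      (fun y hy => hF p hp y (hsub hy)) hL0 hN0 hε.le hε1 hx
  have hk0 : 0 ≤ k := (norm_nonneg _).trans (hTm p₀ hp₀ 0 (mem_ball_self hr))
  have hkr : k < r := by
    rw [div_lt_iff₀ hpos]
    nlinarith [mul_lt_mul_of_pos_left hε2 hε]
  -- The midpoint, unlike `k`, is certainly positive.
  set r' := (k + r) / 2
  have hr'0 : 0 < r' := by positivity
  have hr'r : r' < r := by simp only [r']; linarith
  have hkr' : k ≤ r' := by simp only [r']; linarith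
  have hTd : ∀ p ∈ W, DifferentiableOn ℂ (T p) (ball 0 r) := fun p hp =>
    differentiableOn_id.add (((hFd p hp).mono hsubr).const_smul _)
  have hex : ∀ p, ∃ x, p ∈ W → x ∈ ball (0 : X) r ∧ T p x = x ∧
      (∀ y ∈ ball (0 : X) r, T p y = y → y = x) ∧
      ∀ n, ‖(T p)^[n] 0 - x‖ ≤ 2 * r * (r' / r) ^ n := by
    intro p
    by_cases hp : p ∈ W
    · obtain ⟨x, hx, h⟩ := exists_fixedPoint hr'0 hr'r (hTd p hp)
        fun x hx => (hTm p hp x hx).trans hkr'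
      exact ⟨x, fun _ => ⟨hx, h⟩⟩
    · exact ⟨0, fun h => absurd h hp⟩
  choose x hx using hex
  have hitm : ∀ n, ∀ p ∈ W, (T p)^[n] 0 ∈ ball (0 : X) r := by
    intro n p hp
    induction n with
    | zero => exact mem_ball_self hr
    | succ n ih =>
      rw [Function.iterate_succ_apply', mem_ball_zero_iff]
      exact (hTm p hp _ ih).trans_lt hkr
  have hitd : ∀ n, DifferentiableOn ℂ (fun p => (T p)^[n] 0) W := by
    intro n
    induction n with
    | zero => exact differentiableOn_const _
    | succ n ih =>
      simp only [Function.iterate_succ_apply', T] at ih ⊢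
      refine ih.add (DifferentiableOn.const_smul ?_ _)
      exact hd.comp (differentiableOn_id.prodMk ih) fun p hp => ⟨hp, hsubr (hitm n p hp)⟩
  have hunif : TendstoUniformlyOn (fun n p => (T p)^[n] 0) x atTop W := by
    have hlim : Tendsto (fun n => 2 * r * (r' / r) ^ n) atTop (𝓝 (2 * r * 0)) :=
      (tendsto_pow_atTop_nhds_zero_of_lt_one (by positivity)
        ((div_lt_one hr).2 hr'r)).const_mul _
    rw [mul_zero] at hlim
    rw [Metric.tendstoUniformlyOn_iff]
    intro δ hδ
    filter_upwards [hlim.eventually_lt_const hδ] with n hn p hp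
    rw [dist_comm, dist_eq_norm]
    exact ((hx p hp).2.2.2 n).trans_lt hn
  refine ⟨x, ?_, fun p hp => ⟨(hx p hp).1, (hTfix _ _).1 (hx p hp).2.1, fun y hy hFy =>
    (hx p hp).2.2.1 y hy ((hTfix _ _).2 hFy)⟩⟩
  -- The iterates are holomorphic in `p` and converge uniformly. The one-variable Weierstrass
  -- theorem applies on each complex line, and boundedness by `r` does the rest.
  refine differentiableOn_of_lineDifferentiable hW (M := r) (fun p hp v => ?_)
    fun p hp => (mem_ball_zero_iff.1 (hx p hp).1).le
  have hline : Continuous fun ξ : ℂ => p + ξ • v := by fun_prop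
  have hopen : IsOpen ((fun ξ : ℂ => p + ξ • v) ⁻¹' W) := hW.preimage hline
  have h1 := (hunif.comp (fun ξ : ℂ => p + ξ • v)).tendstoLocallyUniformlyOn
  have h2 : DifferentiableOn ℂ (x ∘ fun ξ : ℂ => p + ξ • v) ((fun ξ : ℂ => p + ξ • v) ⁻¹' W) :=
    h1.differentiableOn (Eventually.of_forall fun n =>
      (hitd n).comp (f := fun ξ : ℂ => p + ξ • v) (by fun_prop) fun ξ hξ => hξ) hopen
  exact h2.differentiableAt (hopen.mem_nhds (by simpa using hp))

end FixedPoint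

/-! ### Holomorphy of the semiflow -/

section Flow

open Filter Topology Asymptotics

variable {X : Type*} [NormedAddCommGroup X] [NormedSpace ℂ X]

omit [NormedSpace ℂ X] in
theorem IsCompact.exists_norm_le_on_balls {h : X → X} {K D : Set X} (hK : IsCompact K)
    (hD : IsOpen D) (hKD : K ⊆ D) (hh : ContinuousOn h D) :
    ∃ δ > 0, ∃ M, ∀ x ∈ K, ∀ y ∈ ball x δ, y ∈ D ∧ ‖h y‖ ≤ M := by
  obtain ⟨M, hM⟩ := hK.exists_bound_of_continuousOn (hh.mono hKD)
  have hU : IsOpen (D ∩ h ⁻¹' ball 0 (M + 1)) := hh.isOpen_inter_preimage hD isOpen_ball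
  obtain ⟨δ, hδ, hsub⟩ := hK.exists_thickening_subset_open hU fun x hx =>
    ⟨hKD hx, mem_ball_zero_iff.2 ((hM x hx).trans_lt (lt_add_one M))⟩
  refine ⟨δ, hδ, M + 1, fun x hx y hy => ?_⟩
  have := hsub (mem_thickening_iff.2 ⟨x, hx, hy⟩)
  exact ⟨this.1, (mem_ball_zero_iff.1 this.2).le⟩

/-- A Gronwall estimate where the differential inequality is needed only on the barrier. -/
theorem norm_le_mul_exp_of_norm_deriv_le {f f' : ℝ → X} {T K d : ℝ} (hd : 0 < d)
    (hK : 0 ≤ K) (hf : ContinuousOn f (Icc 0 T))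
    (hf' : ∀ t ∈ Ico 0 T, HasDerivWithinAt f (f' t) (Ici t) t) (h0 : ‖f 0‖ ≤ d)
    (bound : ∀ t ∈ Ico 0 T, ‖f t‖ = d * Real.exp ((K + 2) * t) → ‖f' t‖ ≤ K * ‖f t‖ + d) :
    ∀ t ∈ Icc 0 T, ‖f t‖ ≤ d * Real.exp ((K + 2) * t) := by
  have hB : ∀ t : ℝ, HasDerivAt (fun t => d * Real.exp ((K + 2) * t))
      (d * (Real.exp ((K + 2) * t) * ((K + 2) * 1))) t := fun t =>
    (((hasDerivAt_id t).const_mul (K + 2)).exp).const_mul d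
  refine image_norm_le_of_norm_deriv_right_lt_deriv_boundary hf hf' (by simpa using h0) hB ?_
  intro t ht hft
  refine (bound t ht hft).trans_lt ?_
  rw [hft]
  -- On the barrier `K ‖f‖ + d ≤ (K + 1) d e^{(K+2)t}`, strictly below the barrier's slope; hence
  -- the rate `K + 2`.
  have h1 : 1 ≤ Real.exp ((K + 2) * t) := Real.one_le_exp (mul_nonneg (by linarith) ht.1)
  nlinarith [mul_le_mul_of_nonneg_left h1 hd.le]

variable {h : X → X} {D : Set X} {x y : ℝ → X}

/-- `h` obeys a `2M/δ` Lipschitz estimate from the centre of each ball of the tube, and `hdδ` keeps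
the barrier inside the tube, so `y` cannot escape. -/
theorem norm_sub_le_of_trajectories {T δ M d : ℝ} (hD : IsOpen D)
    (hol : DifferentiableOn ℂ h D)
    (hx : ∀ t : ℝ, 0 ≤ t → HasDerivWithinAt x (h (x t)) (Ici 0) t)
    (hy : ∀ t : ℝ, 0 ≤ t → HasDerivWithinAt y (h (y t)) (Ici 0) t)
    (hT : 0 ≤ T) (hδ : 0 < δ) (htube : ∀ t ∈ Icc 0 T, ∀ z ∈ ball (x t) δ, z ∈ D ∧ ‖h z‖ ≤ M)
    (hd : 0 < d) (hdδ : d * Real.exp ((2 * M / δ + 2) * T) < δ) (h0 : ‖y 0 - x 0‖ ≤ d) :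
    ∀ t ∈ Icc 0 T, ‖y t - x t‖ ≤ d * Real.exp ((2 * M / δ + 2) * t) := by
  have hM : 0 ≤ M := (norm_nonneg _).trans
    (htube 0 (left_mem_Icc.2 hT) _ (mem_ball_self hδ)).2
  have hK : 0 ≤ 2 * M / δ := by positivity
  refine norm_le_mul_exp_of_norm_deriv_le (f' := fun t => h (y t) - h (x t)) hd hK ?_ ?_ h0 ?_
  · intro t ht
    exact (((hy t ht.1).sub (hx t ht.1)).continuousWithinAt).mono Icc_subset_Ici_self
  · intro t ht
    exact ((hy t ht.1).sub (hx t ht.1)).mono (Ici_subset_Ici.2 ht.1)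
  · intro t ht hft
    have htI := Ico_subset_Icc_self ht
    have hlt : ‖y t - x t‖ < δ := by
      rw [hft]
      refine lt_of_le_of_lt ?_ hdδ
      gcongr
      exact ht.2.le
    have := norm_add_sub_le_of_lineDifferentiable (w := y t - x t)
      (fun z hz v => hol.lineDifferentiableAt_of_isOpen hD (htube t htI z hz).1 v)
      (fun z hz => (htube t htI z hz).2) hlt
    rw [add_sub_cancel] at this
    linarith

/-- A map into a complete space whose difference quotients along a line are Cauchy is
differentiable along this line. -/
theorem lineDifferentiableAt_of_slope_bound [CompleteSpace X] {f : X → X} {x v : X} {η C : ℝ}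
    (hη : 0 < η) (hC : 0 < C) (hf : ∀ a : ℂ, a ≠ 0 → ‖a‖ < η → ∀ b : ℂ, b ≠ 0 → ‖b‖ < η →
      ‖a⁻¹ • (f (x + a • v) - f x) - b⁻¹ • (f (x + b • v) - f x)‖ ≤ C * (‖a‖ + ‖b‖)) :
    LineDifferentiableAt ℂ f x v := by
  have hCau : Cauchy (map (fun a : ℂ => a⁻¹ • (f (x + a • v) - f x)) (𝓝[≠] 0)) := by
    rw [Metric.cauchy_iff]
    refine ⟨inferInstance, fun ε hε => ?_⟩
    obtain ⟨ρ, hρ, hρη, hρε⟩ : ∃ ρ > 0, ρ ≤ η ∧ C * (ρ + ρ) ≤ ε := by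
      refine ⟨min η (ε / (2 * C)), by positivity, min_le_left _ _, ?_⟩
      have : min η (ε / (2 * C)) ≤ ε / (2 * C) := min_le_right _ _
      rw [le_div_iff₀ (by positivity)] at this
      linarith
    refine ⟨_, image_mem_map (inter_mem (mem_nhdsWithin_of_mem_nhds (ball_mem_nhds 0 hρ))
      self_mem_nhdsWithin), ?_⟩
    rintro _ ⟨a, ⟨ha, ha0⟩, rfl⟩ _ ⟨b, ⟨hb, hb0⟩, rfl⟩
    rw [mem_ball_zero_iff] at ha hb
    rw [dist_eq_norm]
    refine (hf a ha0 (ha.trans_le hρη) b hb0 (hb.trans_le hρη)).trans_lt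
      (lt_of_lt_of_le ?_ hρε)
    gcongr
  obtain ⟨l, hl⟩ := CompleteSpace.complete hCau
  exact (hasLineDerivAt_iff_tendsto_slope_zero.2 hl).lineDifferentiableAt

theorem norm_inv_smul_sub_sub_fderiv_le {h : X → X} {p q : X} {δ M S : ℝ} {a : ℂ} (ha : a ≠ 0)
    (hol : DifferentiableOn ℂ h (ball p δ)) (hM : ∀ z ∈ ball p δ, ‖h z‖ ≤ M) (hq : ‖q - p‖ < δ)
    (hS : ‖q - p‖ ≤ ‖a‖ * S) :
    ‖a⁻¹ • (h q - h p) - fderiv ℂ h p (a⁻¹ • (q - p))‖ ≤ 4 * M / δ ^ 2 * S ^ 2 * ‖a‖ := by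
  have hδ : 0 < δ := (norm_nonneg _).trans_lt hq
  have hM0 : 0 ≤ M := (norm_nonneg _).trans (hM p (mem_ball_self hδ))
  have h2 := (norm_add_sub_sub_lineDeriv_le (w := q - p)
    (fun z hz v => hol.lineDifferentiableAt_of_isOpen isOpen_ball hz v) hM hq).1
  rw [(hol.differentiableAt (isOpen_ball.mem_nhds (mem_ball_self hδ))).lineDeriv_eq_fderiv,
    add_sub_cancel] at h2
  rw [map_smul, ← smul_sub, norm_smul, norm_inv, inv_mul_le_iff₀ (norm_pos_iff.2 ha)]
  refine h2.trans ?_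
  calc 4 * M / δ ^ 2 * ‖q - p‖ ^ 2 ≤ 4 * M / δ ^ 2 * (‖a‖ * S) ^ 2 := by gcongr
    _ = _ := by ring

/-- The time `T` map of a holomorphic vector field is holomorphic along complex lines. -/
theorem lineDifferentiableAt_flow [CompleteSpace X] {φ : X → ℝ → X} (hD : IsOpen D)
    (hol : DifferentiableOn ℂ h D) (hφ0 : ∀ x ∈ D, φ x 0 = x)
    (hφ : ∀ x ∈ D, ∀ t : ℝ, 0 ≤ t → φ x t ∈ D ∧ HasDerivWithinAt (φ x) (h (φ x t)) (Ici 0) t)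
    {T : ℝ} (hT : 0 ≤ T) {x : X} (hx : x ∈ D) (v : X) :
    LineDifferentiableAt ℂ (fun x => φ x T) x v := by
  have hcont : ContinuousOn (φ x) (Icc 0 T) := fun t ht =>
    ((hφ x hx t ht.1).2.continuousWithinAt).mono Icc_subset_Ici_self
  obtain ⟨δ, hδ, M, hδM⟩ := (isCompact_Icc.image_of_continuousOn hcont).exists_norm_le_on_balls hD
    (image_subset_iff.2 fun t ht => (hφ x hx t ht.1).1) hol.continuousOn
  have htube : ∀ t ∈ Icc 0 T, ∀ z ∈ ball (φ x t) δ, z ∈ D ∧ ‖h z‖ ≤ M := fun t ht =>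
    hδM _ (mem_image_of_mem _ ht)
  have hM : 0 ≤ M := (norm_nonneg _).trans
    (htube 0 (left_mem_Icc.2 hT) _ (mem_ball_self hδ)).2
  set K := 2 * M / δ with hKdef
  have hK : 0 ≤ K := by positivity
  set E := Real.exp ((K + 2) * T)
  have hE : 0 < E := Real.exp_pos _
  have hEt : ∀ t ∈ Icc 0 T, Real.exp ((K + 2) * t) ≤ E := fun t ht =>
    Real.exp_le_exp.2 (mul_le_mul_of_nonneg_left ht.2 (by linarith))
  set V := ‖v‖ + 1
  have hV : 0 < V := by positivity
  set C := 4 * M / δ ^ 2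
  have hC : 0 ≤ C := by positivity
  obtain ⟨η, hη, hηD, hηδ⟩ : ∃ η > 0, (∀ a : ℂ, ‖a‖ < η → x + a • v ∈ D) ∧
      ∀ a : ℂ, ‖a‖ < η → ‖a‖ * V * E < δ := by
    have h1 : ∀ᶠ a : ℂ in 𝓝 0, x + a • v ∈ D :=
      ContinuousAt.eventually_mem (by fun_prop) (hD.mem_nhds (by simpa using hx))
    have h2 : ∀ᶠ a : ℂ in 𝓝 0, ‖a‖ * V * E < δ :=
      ContinuousAt.eventually_lt (by fun_prop) (by fun_prop) (by simpa)
    obtain ⟨η, hη, hsub⟩ := Metric.eventually_nhds_iff_ball.1 (h1.and h2)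
    exact ⟨η, hη, fun a ha => (hsub a (mem_ball_zero_iff.2 ha)).1,
      fun a ha => (hsub a (mem_ball_zero_iff.2 ha)).2⟩
  let w : ℂ → ℝ → X := fun a t => φ (x + a • v) t - φ x t
  have hw0 : ∀ a : ℂ, ‖a‖ < η → w a 0 = a • v := fun a ha => by
    simp only [w, hφ0 _ hx, hφ0 _ (hηD a ha), add_sub_cancel_left]
  have hw : ∀ a : ℂ, a ≠ 0 → ‖a‖ < η → ∀ t ∈ Icc 0 T, ‖w a t‖ ≤ ‖a‖ * V * E := by
    intro a ha0 ha t ht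
    have hpos : 0 < ‖a‖ * V := mul_pos (norm_pos_iff.2 ha0) hV
    have := norm_sub_le_of_trajectories hD hol (fun t ht => (hφ x hx t ht).2)
      (fun t ht => (hφ _ (hηD a ha) t ht).2) hT hδ htube hpos (hηδ a ha) (by
        change ‖w a 0‖ ≤ _
        rw [hw0 a ha, norm_smul]
        exact mul_le_mul_of_nonneg_left (by simp only [V]; linarith) (norm_nonneg _)) t ht
    exact this.trans (mul_le_mul_of_nonneg_left (hEt t ht) hpos.le)
  have hwd : ∀ a : ℂ, ‖a‖ < η → ∀ t : ℝ, 0 ≤ t →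
      HasDerivWithinAt (w a) (h (φ (x + a • v) t) - h (φ x t)) (Ici 0) t := fun a ha t ht =>
    (hφ _ (hηD a ha) t ht).2.sub (hφ x hx t ht).2
  let A : ℝ → X →L[ℂ] X := fun t => fderiv ℂ h (φ x t)
  have htaylor : ∀ a : ℂ, a ≠ 0 → ‖a‖ < η → ∀ t ∈ Icc 0 T,
      ‖a⁻¹ • (h (φ (x + a • v) t) - h (φ x t)) - A t (a⁻¹ • w a t)‖ ≤
        C * (V * E) ^ 2 * ‖a‖ := by
    intro a ha0 ha t ht
    have h1 := hw a ha0 ha t ht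
    exact norm_inv_smul_sub_sub_fderiv_le ha0 (hol.mono fun z hz => (htube t ht z hz).1)
      (fun z hz => (htube t ht z hz).2) (h1.trans_lt (hηδ a ha)) (by rwa [← mul_assoc])
  have hAK : ∀ t ∈ Icc 0 T, ∀ u, ‖A t u‖ ≤ K * ‖u‖ := by
    intro t ht u
    refine (A t).le_of_opNorm_le ?_ u
    refine Complex.norm_fderiv_le_div_of_mapsTo_ball (R₁ := δ) (R₂ := 2 * M)
      (hol.mono fun z hz => (htube t ht z hz).1) (fun z hz => ?_) hδ
    rw [mem_closedBall, dist_eq_norm]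
    have h1 := (htube t ht z hz).2
    have h2 := (htube t ht _ (mem_ball_self hδ)).2
    linarith [norm_sub_le (h z) (h (φ x t))]
  set C' := C * (V * E) ^ 2 + 1
  have hC' : 0 < C' := by positivity
  -- Both quotients start at `v` and solve the variational equation `u' = A u` up to errors `O(|a|)`
  -- and `O(|b|)`; Gronwall makes them Cauchy.
  have hcauchy : ∀ a : ℂ, a ≠ 0 → ‖a‖ < η → ∀ b : ℂ, b ≠ 0 → ‖b‖ < η →
      ‖a⁻¹ • w a T - b⁻¹ • w b T‖ ≤ C' * (‖a‖ + ‖b‖) * E := by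
    intro a ha0 ha b hb0 hb
    have hap := norm_pos_iff.2 ha0
    have hbp := norm_pos_iff.2 hb0
    have hder : ∀ t : ℝ, 0 ≤ t → HasDerivWithinAt (fun t => a⁻¹ • w a t - b⁻¹ • w b t)
        (a⁻¹ • (h (φ (x + a • v) t) - h (φ x t)) - b⁻¹ • (h (φ (x + b • v) t) - h (φ x t)))
        (Ici 0) t := fun t ht =>
      ((hwd a ha t ht).const_smul a⁻¹).sub ((hwd b hb t ht).const_smul b⁻¹)
    refine norm_le_mul_exp_of_norm_deriv_le (f := fun t => a⁻¹ • w a t - b⁻¹ • w b t)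
      (mul_pos hC' (add_pos hap hbp)) hK ?_
      (fun t ht => (hder t ht.1).mono (Ici_subset_Ici.2 ht.1)) ?_ ?_ T (right_mem_Icc.2 hT)
    · exact fun t ht => ((hder t ht.1).continuousWithinAt).mono Icc_subset_Ici_self
    · rw [hw0 a ha, hw0 b hb, inv_smul_smul₀ ha0, inv_smul_smul₀ hb0, sub_self, norm_zero]
      positivity
    · intro t ht _
      have htI := Ico_subset_Icc_self ht
      have h1 := htaylor a ha0 ha t htI
      have h2 := htaylor b hb0 hb t htI
      have h3 := hAK t htI (a⁻¹ • w a t - b⁻¹ • w b t)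
      set p := a⁻¹ • (h (φ (x + a • v) t) - h (φ x t))
      set q := b⁻¹ • (h (φ (x + b • v) t) - h (φ x t))
      have e : p - q = A t (a⁻¹ • w a t - b⁻¹ • w b t) + ((p - A t (a⁻¹ • w a t)) -
          (q - A t (b⁻¹ • w b t))) := by
        rw [map_sub]; abel
      rw [e]
      refine (norm_add_le _ _).trans (add_le_add h3 ((norm_sub_le _ _).trans ?_))
      refine (add_le_add h1 h2).trans ?_
      simp only [C']
      nlinarith
  exact lineDifferentiableAt_of_slope_bound hη (mul_pos hC' hE) fun a ha0 ha b hb0 hb =>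
    (hcauchy a ha0 ha b hb0 hb).trans_eq (mul_right_comm _ _ _)

/-- The semigroup of holomorphic self-maps of the unit ball generated by a semi-complete
holomorphic vector field vanishing at the origin. -/
theorem IsSemiComplete.exists_semiflow [CompleteSpace X] (hsc : IsSemiComplete h (ball 0 1))
    (hol : DifferentiableOn ℂ h (ball 0 1)) (h0 : h 0 = 0) :
    ∃ φ : ℝ → X → X, ∀ t : ℝ, 0 ≤ t → DifferentiableOn ℂ (φ t) (ball 0 1) ∧
      ∀ x ∈ ball (0 : X) 1, φ 0 x = x ∧ ‖φ t x‖ ≤ ‖x‖ ∧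
        HasDerivWithinAt (fun t => φ t x) (h (φ t x)) (Ici 0) t := by
  have hex : ∀ x₀ : X, ∃ x : ℝ → X, x₀ ∈ ball (0 : X) 1 → x 0 = x₀ ∧
      ∀ t : ℝ, 0 ≤ t → x t ∈ ball (0 : X) 1 ∧ HasDerivWithinAt x (h (x t)) (Ici 0) t := by
    intro x₀
    by_cases hx₀ : x₀ ∈ ball (0 : X) 1
    · obtain ⟨x, hx⟩ := hsc x₀ hx₀
      exact ⟨x, fun _ => hx⟩
    · exact ⟨fun _ => 0, fun h => absurd h hx₀⟩
  choose φ hφ using hex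
  have hB0 : (0 : X) ∈ ball (0 : X) 1 := mem_ball_self one_pos
  refine ⟨fun t x => φ x t, fun T hT => ?_⟩
  have hdiff : DifferentiableOn ℂ (fun x => φ x T) (ball 0 1) :=
    differentiableOn_of_lineDifferentiable isOpen_ball (M := 1)
      (fun x hx v => lineDifferentiableAt_flow isOpen_ball hol (fun x hx => (hφ x hx).1)
        (fun x hx => (hφ x hx).2) hT hx v)
      fun x hx => (mem_ball_zero_iff.1 ((hφ x hx).2 T hT).1).le
  -- Uniqueness at the equilibrium: comparison with the constant trajectory 0, then `d → 0`.
  have hzero : φ 0 T = 0 := by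
    obtain ⟨δ, hδ, M, hδM⟩ := (isCompact_singleton (x := (0 : X))).exists_norm_le_on_balls
      isOpen_ball (singleton_subset_iff.2 hB0) hol.continuousOn
    have key : ∀ᶠ d : ℝ in 𝓝[>] 0, ‖φ 0 T‖ ≤ d * Real.exp ((2 * M / δ + 2) * T) := by
      have h1 : ∀ᶠ d : ℝ in 𝓝[>] 0, d * Real.exp ((2 * M / δ + 2) * T) < δ :=
        nhdsWithin_le_nhds (ContinuousAt.eventually_lt (by fun_prop) (by fun_prop) (by simpa))
      filter_upwards [h1, self_mem_nhdsWithin] with d hd hd0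
      have := norm_sub_le_of_trajectories (x := fun _ => 0) (y := φ 0) isOpen_ball hol
        (fun t _ => by rw [h0]; exact hasDerivWithinAt_const _ _ _)
        (fun t ht => ((hφ 0 hB0).2 t ht).2) hT hδ (fun t _ z hz => hδM 0 rfl z hz)
        hd0 hd (by rw [(hφ 0 hB0).1, sub_zero, norm_zero]; exact le_of_lt hd0) T
        (right_mem_Icc.2 hT)
      simpa using this
    have hlim : Tendsto (fun d : ℝ => d * Real.exp ((2 * M / δ + 2) * T)) (𝓝[>] 0) (𝓝 0) :=
      (Continuous.tendsto' (by fun_prop) 0 0 (by simp)).mono_left nhdsWithin_le_nhds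
    exact norm_le_zero_iff.1 (ge_of_tendsto hlim key)
  refine ⟨hdiff, fun x hx => ⟨(hφ x hx).1, ?_, ((hφ x hx).2 T hT).2⟩⟩
  exact Complex.norm_le_norm_of_mapsTo_ball hdiff
    (fun z hz => ball_subset_closedBall ((hφ z hz).2 T hT).1) hzero (mem_ball_zero_iff.1 hx)

end Flow

/-! ### Dissipativity, numerical range and boundedness -/

section Dissipative

open Filter Topology Asymptotics ComplexConjugate

variable {X : Type*} [NormedAddCommGroup X] [NormedSpace ℂ X]

/-- `h` is dissipative on `D`: `Re ℓ (h x) ≤ 0` for every support functional `ℓ` at `x ∈ D`. -/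
def IsDissipativeOn (h : X → X) (D : Set X) : Prop :=
  ∀ x ∈ D, ∀ ℓ : StrongDual ℂ X, ‖ℓ‖ ≤ 1 → ℓ x = ‖x‖ → (ℓ (h x)).re ≤ 0

variable {h : X → X}

theorem StrongDual.re_le_norm {ℓ : StrongDual ℂ X} (hℓ : ‖ℓ‖ ≤ 1) (z : X) : (ℓ z).re ≤ ‖z‖ :=
  (Complex.re_le_norm _).trans ((ℓ.le_opNorm z).trans (mul_le_of_le_one_left (norm_nonneg _) hℓ))

/-- The values of a dissipative holomorphic vector field on support functionals are governed by
those of its derivative at the origin. -/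
theorem IsDissipativeOn.norm_apply_sub_le (hdis : IsDissipativeOn h (ball 0 1))
    (hol : DifferentiableOn ℂ h (ball 0 1)) (h0 : h 0 = 0) {y : X} (hy : y ∈ ball (0 : X) 1)
    {ℓ : StrongDual ℂ X} (hℓ : ‖ℓ‖ ≤ 1) (hℓy : ℓ y = ‖y‖)
    (hneg : (ℓ (fderiv ℂ h 0 y)).re < 0) :
    ‖ℓ (h y) - ℓ (fderiv ℂ h 0 y)‖ ≤ ‖y‖ * ‖ℓ (h y) + conj (ℓ (fderiv ℂ h 0 y))‖ := by
  have hy0 : y ≠ 0 := by rintro rfl; simp at hneg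
  have hpos := norm_pos_iff.2 hy0
  have hyC : (‖y‖ : ℂ) ≠ 0 := by exact_mod_cast hpos.ne'
  set u : X := (‖y‖ : ℂ)⁻¹ • y with hu
  have hun : ‖u‖ = 1 := by
    rw [hu, norm_smul, norm_inv, Complex.norm_real, norm_norm, inv_mul_cancel₀ hpos.ne']
  have hyu : y = (‖y‖ : ℂ) • u := by rw [hu, smul_inv_smul₀ hyC]
  have hℓu : ℓ u = 1 := by rw [hu, map_smul, hℓy, smul_eq_mul, inv_mul_cancel₀ hyC]
  have hmem : ∀ ζ ∈ ball (0 : ℂ) 1, ζ • u ∈ ball (0 : X) 1 := fun ζ hζ => by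
    rw [mem_ball_zero_iff] at hζ ⊢
    rwa [norm_smul, hun, mul_one]
  let G : ℂ → ℂ := fun ζ => -ℓ (h (ζ • u))
  have hG0 : G 0 = 0 := by simp [G, h0]
  have hGd : DifferentiableOn ℂ G (ball 0 1) :=
    (ℓ.differentiable.comp_differentiableOn
      (hol.comp (f := fun ζ : ℂ => ζ • u) (by fun_prop) hmem)).neg
  have hB : ball (0 : ℂ) 1 ∈ 𝓝 0 := ball_mem_nhds _ one_pos
  -- `dslope G 0` is `-ℓ (h (ζ u)) / ζ` with the singularity at 0 removed.
  have hgd : DifferentiableOn ℂ (dslope G 0) (ball 0 1) :=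
    (Complex.differentiableOn_dslope hB).2 hGd
  have hg0 : dslope G 0 0 = -ℓ (fderiv ℂ h 0 u) := by
    rw [dslope_same]
    have h1 : HasFDerivAt h (fderiv ℂ h 0) ((0 : ℂ) • u) := by
      rw [zero_smul]
      exact (hol.differentiableAt (ball_mem_nhds _ one_pos)).hasFDerivAt
    have h2 : HasDerivAt (fun ζ : ℂ => ζ • u) ((1 : ℂ) • u) 0 := (hasDerivAt_id _).smul_const u
    have h3 := (ℓ.hasFDerivAt.comp_hasDerivAt (0 : ℂ) (h1.comp_hasDerivAt (0 : ℂ) h2)).neg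
    rw [one_smul] at h3
    exact h3.deriv
  have hgne : ∀ ζ : ℂ, ζ ≠ 0 → dslope G 0 ζ = -(ζ⁻¹ * ℓ (h (ζ • u))) := fun ζ hζ => by
    rw [dslope_of_ne _ hζ, slope_def_module, hG0, sub_zero, sub_zero, smul_eq_mul, mul_neg]
  have hyA : ℓ (fderiv ℂ h 0 u) = (‖y‖ : ℂ)⁻¹ * ℓ (fderiv ℂ h 0 y) := by
    rw [hu, map_smul, map_smul, smul_eq_mul]
  have hg0pos : 0 < (dslope G 0 0).re := by
    rw [hg0, hyA, ← Complex.ofReal_inv, Complex.neg_re, Complex.re_ofReal_mul]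
    nlinarith [inv_pos.2 hpos]
  have hre : ∀ ζ ∈ ball (0 : ℂ) 1, 0 ≤ (dslope G 0 ζ).re := by
    intro ζ hζ
    rcases eq_or_ne ζ 0 with rfl | hζ0
    · exact hg0pos.le
    have hζp := norm_pos_iff.2 hζ0
    have hζC : (‖ζ‖ : ℂ) ≠ 0 := by exact_mod_cast hζp.ne'
    -- Rotating `ℓ` by `|ζ| / ζ` gives a support functional at `ζ u`.
    have key := hdis (ζ • u) (hmem ζ hζ) ((‖ζ‖ * ζ⁻¹ : ℂ) • ℓ) ?_ ?_
    · rw [hgne ζ hζ0, Complex.neg_re, Left.nonneg_neg_iff]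
      rw [smul_apply, smul_eq_mul, mul_assoc, Complex.re_ofReal_mul] at key
      exact nonpos_of_mul_nonpos_right key hζp
    · rw [norm_smul, norm_mul, norm_inv, Complex.norm_real, norm_norm, mul_inv_cancel₀ hζp.ne',
        one_mul]
      exact hℓ
    · rw [smul_apply, map_smul, hℓu, norm_smul, hun, smul_eq_mul, smul_eq_mul,
        mul_one, mul_one, mul_assoc, inv_mul_cancel₀ hζ0, mul_one]
  have hyball : (‖y‖ : ℂ) ∈ ball (0 : ℂ) 1 := by
    rw [mem_ball_zero_iff] at hy ⊢
    simpa using hy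
  have key := norm_sub_le_of_re_nonneg hgd hre hg0pos hyball
  rw [hgne _ hyC, ← hyu, hg0, hyA, Complex.norm_real, norm_norm] at key
  have e1 : -((‖y‖ : ℂ)⁻¹ * ℓ (h y)) - -((‖y‖ : ℂ)⁻¹ * ℓ (fderiv ℂ h 0 y)) =
      -(‖y‖ : ℂ)⁻¹ * (ℓ (h y) - ℓ (fderiv ℂ h 0 y)) := by ring
  have e2 : -((‖y‖ : ℂ)⁻¹ * ℓ (h y)) + conj (-((‖y‖ : ℂ)⁻¹ * ℓ (fderiv ℂ h 0 y))) =
      -(‖y‖ : ℂ)⁻¹ * (ℓ (h y) + conj (ℓ (fderiv ℂ h 0 y))) := by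
    rw [map_neg, map_mul, map_inv₀, Complex.conj_ofReal]; ring
  rw [e1, e2, norm_mul, norm_mul, norm_neg, norm_inv, Complex.norm_real, norm_norm,
    mul_left_comm] at key
  exact le_of_mul_le_mul_left key (inv_pos.2 hpos)

/-- The same `ℓ` supports `t y` for `t > 0`; divide the dissipativity inequality at `t y` by `t` and
let `t → 0`. -/
theorem IsDissipativeOn.re_apply_fderiv_nonpos (hdis : IsDissipativeOn h (ball 0 1))
    (hd : DifferentiableAt ℂ h 0) (h0 : h 0 = 0) {y : X}
    {ℓ : StrongDual ℂ X} (hℓ : ‖ℓ‖ ≤ 1) (hℓy : ℓ y = ‖y‖) :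
    (ℓ (fderiv ℂ h 0 y)).re ≤ 0 := by
  have h1 := hasLineDerivAt_iff_tendsto_slope_zero.1 (hd.hasFDerivAt.hasLineDerivAt y)
  have h2 : Tendsto (fun t : ℝ => (t : ℂ)) (𝓝[>] 0) (𝓝[≠] 0) := by
    refine tendsto_nhdsWithin_iff.2 ⟨?_, ?_⟩
    · exact (Complex.continuous_ofReal.tendsto' 0 0 (by simp)).mono_left nhdsWithin_le_nhds
    · filter_upwards [self_mem_nhdsWithin] with t ht
      exact Complex.ofReal_ne_zero.2 (ne_of_gt ht)
  have h3 := (Complex.continuous_re.comp ℓ.continuous).continuousAt.tendsto.comp (h1.comp h2)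
  refine le_of_tendsto h3 ?_
  have h4 : ∀ᶠ t : ℝ in 𝓝[>] 0, (t : ℂ) • y ∈ ball (0 : X) 1 := nhdsWithin_le_nhds
    (ContinuousAt.eventually_mem (by fun_prop)
      (isOpen_ball.mem_nhds (by simp)))
  filter_upwards [h4, self_mem_nhdsWithin] with t ht ht0
  have ht0' : 0 < t := ht0
  simp only [Function.comp_apply, zero_add, h0, sub_zero, map_smul, smul_eq_mul]
  rw [← Complex.ofReal_inv, Complex.re_ofReal_mul]
  refine mul_nonpos_of_nonneg_of_nonpos (inv_nonneg.2 ht0'.le) (hdis _ ht ℓ hℓ ?_)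
  rw [map_smul, hℓy, norm_smul, Complex.norm_real, Real.norm_of_nonneg ht0'.le, smul_eq_mul,
    Complex.ofReal_mul]

/-- A bound for the numerical range of a dissipative holomorphic vector field. -/
theorem IsDissipativeOn.norm_apply_le (hdis : IsDissipativeOn h (ball 0 1))
    (hol : DifferentiableOn ℂ h (ball 0 1)) (h0 : h 0 = 0) {A s : ℝ}
    (hA : ‖fderiv ℂ h 0‖ ≤ A) (hs : s < 1) {y : X} (hy : ‖y‖ ≤ s)
    {ℓ : StrongDual ℂ X} (hℓ : ‖ℓ‖ ≤ 1) (hℓy : ℓ y = ‖y‖) :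
    ‖ℓ (h y)‖ ≤ ((1 + s) * (A + 1) / (1 - s) + 1) * ‖y‖ := by
  rcases eq_or_ne y 0 with rfl | hy0
  · simp [h0]
  have hpos := norm_pos_iff.2 hy0
  have hd0 : DifferentiableAt ℂ h 0 := hol.differentiableAt (ball_mem_nhds _ one_pos)
  -- Subtracting the identity makes the derivative term strictly negative, as `norm_apply_sub_le`
  -- requires.
  have hdis' : IsDissipativeOn (fun x => h x - x) (ball 0 1) := by
    intro x hx ℓ hℓ hℓx
    have := hdis x hx ℓ hℓ hℓx
    simp only [map_sub, Complex.sub_re, hℓx, Complex.ofReal_re]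
    linarith [norm_nonneg x]
  have hfd : fderiv ℂ (fun x => h x - x) 0 y = fderiv ℂ h 0 y - y := by
    have := (hd0.hasFDerivAt.sub (hasFDerivAt_id (0 : X))).fderiv
    simp only [id_eq, Pi.sub_def] at this
    rw [this]; rfl
  have hB : ‖ℓ (fderiv ℂ h 0 y - y)‖ ≤ (A + 1) * ‖y‖ := by
    refine (ℓ.le_opNorm _).trans ((mul_le_of_le_one_left (norm_nonneg _) hℓ).trans ?_)
    have := (fderiv ℂ h 0).le_of_opNorm_le hA y
    linarith [norm_sub_le (fderiv ℂ h 0 y) y]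
  have key := hdis'.norm_apply_sub_le (hol.sub differentiableOn_id) (by simp [h0])
    (mem_ball_zero_iff.2 (hy.trans_lt hs)) hℓ hℓy (by
      rw [hfd, map_sub, hℓy, Complex.sub_re, Complex.ofReal_re]
      linarith [hdis.re_apply_fderiv_nonpos hd0 h0 hℓ hℓy])
  rw [hfd] at key
  set p := ℓ (h y - y)
  set q := ℓ (fderiv ℂ h 0 y - y)
  have h1 : ‖p‖ - ‖q‖ ≤ ‖p - q‖ := norm_sub_norm_le _ _
  have h2 : ‖p + conj q‖ ≤ ‖p‖ + ‖q‖ := by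
    simpa using norm_add_le p (conj q)
  have h3 : ‖y‖ * ‖p + conj q‖ ≤ s * (‖p‖ + ‖q‖) :=
    mul_le_mul hy h2 (norm_nonneg _) (hpos.le.trans hy)
  have h4 : (1 - s) * ‖p‖ ≤ (1 + s) * ‖q‖ := by linarith
  have h5 : ‖p‖ ≤ (1 + s) * (A + 1) / (1 - s) * ‖y‖ := by
    rw [div_mul_eq_mul_div, le_div_iff₀ (by linarith)]
    nlinarith [mul_le_mul_of_nonneg_left hB (by linarith : 0 ≤ 1 + s)]
  have h6 : ℓ (h y) = p + ‖y‖ := by simp only [p, map_sub, hℓy]; ring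
  rw [h6]
  refine (norm_add_le _ _).trans ?_
  rw [Complex.norm_real, norm_norm]
  linarith

/-- A bounded holomorphic vector field is bounded, on smaller balls, in terms of its numerical
range only. -/
theorem norm_le_of_numericalRange_le [CompleteSpace X] {ρ r s N K τ : ℝ}
    (hol : DifferentiableOn ℂ h (ball 0 s)) (hN : ∀ x ∈ ball (0 : X) s, ‖h x‖ ≤ N)
    (hK : ∀ y ∈ ball (0 : X) s, ∀ ℓ : StrongDual ℂ X, ‖ℓ‖ ≤ 1 → ℓ y = ‖y‖ →
      ‖ℓ (h y)‖ ≤ K * ‖y‖)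
    (hr : 0 < r) (hrs : r < s) (hτ : 0 < τ) (hτK : 0 < 1 - τ * K) (hρ : ρ < (1 - τ * K) * r)
    {w : X} (hw : ‖w‖ ≤ ρ) : ‖h w‖ ≤ 2 * r / τ := by
  have hd : DifferentiableOn ℂ (fun q : ℂ × X => w + q.1 • h q.2 - q.2) (ball 0 τ ×ˢ ball 0 s) := by
    refine DifferentiableOn.sub (DifferentiableOn.const_add _ ?_) differentiableOn_snd
    exact differentiableOn_fst.smul (hol.comp differentiableOn_snd fun q hq => hq.2)
  have hNF : ∀ ζ ∈ ball (0 : ℂ) τ, ∀ y ∈ ball (0 : X) s, ‖w + ζ • h y - y‖ ≤ ρ + τ * N + s := by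
    intro ζ hζ y hy
    have h1 := hN y hy
    rw [mem_ball_zero_iff] at hζ hy
    have h2 : ‖ζ • h y‖ ≤ τ * N := by
      rw [norm_smul]; gcongr
    linarith [norm_sub_le (w + ζ • h y) y, norm_add_le w (ζ • h y)]
  have hF : ∀ ζ ∈ ball (0 : ℂ) τ, ∀ y ∈ ball (0 : X) s, ∀ ℓ : StrongDual ℂ X, ‖ℓ‖ ≤ 1 → ℓ y = ‖y‖ →
      (ℓ (w + ζ • h y - y)).re ≤ ρ - (1 - τ * K) * ‖y‖ := by
    intro ζ hζ y hy ℓ hℓ hℓy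
    have h1 := hK y hy ℓ hℓ hℓy
    have h2 : (ζ * ℓ (h y)).re ≤ τ * (K * ‖y‖) := by
      refine (Complex.re_le_norm _).trans ?_
      rw [norm_mul]
      exact mul_le_mul (mem_ball_zero_iff.1 hζ).le h1 (norm_nonneg _) hτ.le
    simp only [map_sub, map_add, map_smul, smul_eq_mul, Complex.sub_re, Complex.add_re, hℓy,
      Complex.ofReal_re]
    linarith [StrongDual.re_le_norm hℓ w]
  -- The solution of `x = w + ζ h(x)` is holomorphic in `ζ`, stays in the ball of radius `r`, and
  -- has derivative `h w` at 0. Cauchy's estimate then bounds `h w` independently of `N`.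
  obtain ⟨x, hxd, hx⟩ := exists_unique_zero_differentiableOn (W := ball (0 : ℂ) τ) isOpen_ball
    (F := fun ζ x => w + ζ • h x - x) hr hrs hτK hρ hd hNF hF
  have hfix : ∀ ζ ∈ ball (0 : ℂ) τ, x ζ = w + ζ • h (x ζ) := fun ζ hζ =>
    (sub_eq_zero.1 (hx ζ hζ).2.1).symm
  have h0 : (0 : ℂ) ∈ ball (0 : ℂ) τ := mem_ball_self hτ
  have hx0 : x 0 = w := by simpa using hfix 0 h0
  have hws : w ∈ ball (0 : X) s := by
    rw [← hx0]; exact ball_subset_ball hrs.le (hx 0 h0).1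
  have hder : HasDerivAt x (h w) 0 := by
    rw [hasDerivAt_iff_tendsto_slope_zero]
    have hc : ContinuousAt (fun ζ => h (x ζ)) 0 := by
      refine ContinuousAt.comp (f := x) ?_ (hxd.continuousOn.continuousAt (ball_mem_nhds _ hτ))
      rw [hx0]
      exact hol.continuousOn.continuousAt (isOpen_ball.mem_nhds hws)
    have hc' := hc.tendsto
    rw [hx0] at hc'
    refine (hc'.mono_left (nhdsWithin_le_nhds (s := {0}ᶜ))).congr' ?_
    filter_upwards [self_mem_nhdsWithin, mem_nhdsWithin_of_mem_nhds (ball_mem_nhds _ hτ)]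
      with ζ hζ0 hζ
    have := hfix ζ hζ
    rw [zero_add, hx0, eq_inv_smul_iff₀ hζ0]
    nth_rewrite 2 [this]
    abel
  have := Complex.norm_deriv_le_div_of_mapsTo_ball (R₂ := 2 * r) hxd (fun ζ hζ => ?_) hτ
  · rwa [hder.deriv] at this
  · rw [mem_closedBall, dist_eq_norm]
    have h1 := mem_ball_zero_iff.1 (hx ζ hζ).1
    have h2 := mem_ball_zero_iff.1 (hx 0 h0).1
    linarith [norm_sub_le (x ζ) (x 0)]

/-- `Re ℓ (φ t x) ≤ ‖φ t x‖ ≤ ‖x‖ = ℓ x`, and `h x` is the right derivative of the flow at time 0.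
-/
theorem IsSemiComplete.isDissipativeOn [CompleteSpace X] (hsc : IsSemiComplete h (ball 0 1))
    (hol : DifferentiableOn ℂ h (ball 0 1)) (h0 : h 0 = 0) : IsDissipativeOn h (ball 0 1) := by
  obtain ⟨φ, hφ⟩ := hsc.exists_semiflow hol h0
  intro x hx ℓ hℓ hℓx
  obtain ⟨hφ0, -, hder⟩ := (hφ 0 le_rfl).2 x hx
  have h1 := (hasDerivWithinAt_iff_tendsto_slope' (s := Ioi (0 : ℝ)) (by simp)).1
    (hder.mono Ioi_subset_Ici_self)
  rw [hφ0] at h1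
  have h3 := (Complex.continuous_re.comp ℓ.continuous).continuousAt.tendsto.comp h1
  refine le_of_tendsto h3 ?_
  filter_upwards [self_mem_nhdsWithin] with t ht
  have ht0 : 0 < t := ht
  have h4 := ((hφ t ht0.le).2 x hx).2.1
  simp only [Function.comp_apply, slope_def_module, sub_zero, hφ0]
  rw [← Complex.coe_smul, map_smul, smul_eq_mul, Complex.re_ofReal_mul, map_sub, hℓx,
    Complex.sub_re, Complex.ofReal_re]
  refine mul_nonpos_of_nonneg_of_nonpos (inv_nonneg.2 ht0.le) ?_
  linarith [StrongDual.re_le_norm hℓ (φ t x)]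

/-- A semi-complete holomorphic vector field vanishing at the origin is bounded on smaller balls. -/
theorem IsSemiComplete.exists_norm_le [CompleteSpace X] (hsc : IsSemiComplete h (ball 0 1))
    (hol : DifferentiableOn ℂ h (ball 0 1)) (h0 : h 0 = 0) {ρ : ℝ} (hρ0 : 0 < ρ) (hρ : ρ < 1) :
    ∃ M, ∀ w ∈ ball (0 : X) ρ, ‖h w‖ ≤ M := by
  obtain ⟨φ, hφ⟩ := hsc.exists_semiflow hol h0
  have hd0 : DifferentiableAt ℂ h 0 := hol.differentiableAt (ball_mem_nhds _ one_pos)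
  obtain ⟨A, hA0, hA⟩ := hd0.isBigO_sub.exists_nonneg
  obtain ⟨δ, hδ, hAδ⟩ := Metric.eventually_nhds_iff_ball.1 (hA.bound)
  simp only [h0, sub_zero] at hAδ
  set r := (1 + ρ) / 2 with hr
  set s := (1 + r) / 2 with hs
  have hρr : ρ < r := by linarith
  have hr1 : r < 1 := by linarith
  have hrs : r < s := by linarith
  have hs1 : s < 1 := by linarith
  set K := (1 + s) * (A + 1) / (1 - s) + 1
  have hK : 0 < K := by
    have : 0 < 1 - s := by linarith
    have : 0 < 1 + s := by linarith
    positivity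
  obtain ⟨τ, hτ, hτK, hτρ⟩ : ∃ τ : ℝ, 0 < τ ∧ 0 < 1 - τ * K ∧ ρ < (1 - τ * K) * r := by
    have h1 : ∀ᶠ τ : ℝ in 𝓝[>] 0, 0 < 1 - τ * K := nhdsWithin_le_nhds
      (ContinuousAt.eventually_lt (by fun_prop) (by fun_prop) (by simp))
    have h2 : ∀ᶠ τ : ℝ in 𝓝[>] 0, ρ < (1 - τ * K) * r := nhdsWithin_le_nhds
      (ContinuousAt.eventually_lt (by fun_prop) (by fun_prop) (by simpa))
    obtain ⟨τ, ⟨h1, h2⟩, h3⟩ := ((h1.and h2).and self_mem_nhdsWithin).exists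
    exact ⟨τ, h3, h1, h2⟩
  refine ⟨2 * r / τ, fun w hw => ?_⟩
  have hw1 : w ∈ ball (0 : X) 1 := ball_subset_ball hρ.le hw
  have h1 := (hasDerivWithinAt_iff_tendsto_slope' (s := Ioi (0 : ℝ)) (by simp)).1
    ((((hφ 0 le_rfl).2 w hw1).2.2).mono Ioi_subset_Ici_self)
  rw [((hφ 0 le_rfl).2 w hw1).1] at h1
  refine le_of_tendsto h1.norm ?_
  filter_upwards [self_mem_nhdsWithin] with t ht
  have ht0 : 0 < t := ht
  -- `H` is bounded only by `2 / t`, but it is dissipative and its derivative at 0 is at most `A`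
  -- for every `t`, so the final bound survives `t → 0`.
  let H : X → X := fun x => (t : ℂ)⁻¹ • (φ t x - x)
  have hslope : slope (fun t => φ t w) 0 t = H w := by
    simp only [slope_def_module, sub_zero, ((hφ 0 le_rfl).2 w hw1).1, H]
    rw [← Complex.ofReal_inv, Complex.coe_smul]
  rw [hslope]
  have htn : ‖(t : ℂ)⁻¹‖ = t⁻¹ := by
    rw [norm_inv, Complex.norm_real, Real.norm_of_nonneg ht0.le]
  have hφt : ∀ x ∈ ball (0 : X) 1, ‖φ t x‖ ≤ ‖x‖ := fun x hx => ((hφ t ht0.le).2 x hx).2.1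
  have hHd : DifferentiableOn ℂ H (ball 0 1) :=
    ((hφ t ht0.le).1.sub differentiableOn_id).const_smul _
  have hHb : ∀ x ∈ ball (0 : X) 1, ‖H x‖ ≤ t⁻¹ * 2 := by
    intro x hx
    rw [norm_smul, htn]
    refine mul_le_mul_of_nonneg_left ?_ (inv_nonneg.2 ht0.le)
    have h3 := hφt x hx
    rw [mem_ball_zero_iff] at hx
    linarith [norm_sub_le (φ t x) x]
  have hH0 : H 0 = 0 := by
    have := hφt 0 (mem_ball_self one_pos)
    rw [norm_zero, norm_le_zero_iff] at this
    simp [H, this]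
  have hHdis : IsDissipativeOn H (ball 0 1) := by
    intro x hx ℓ hℓ hℓx
    simp only [H]
    rw [map_smul, smul_eq_mul, ← Complex.ofReal_inv, Complex.re_ofReal_mul, map_sub, hℓx,
      Complex.sub_re, Complex.ofReal_re]
    refine mul_nonpos_of_nonneg_of_nonpos (inv_nonneg.2 ht0.le) ?_
    linarith [StrongDual.re_le_norm hℓ (φ t x), hφt x hx]
  have hHA : ‖fderiv ℂ H 0‖ ≤ A := by
    refine norm_fderiv_le_of_lip' _ hA0 ?_
    filter_upwards [ball_mem_nhds (0 : X) hδ, ball_mem_nhds (0 : X) one_pos] with x hxδ hx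
    rw [hH0, sub_zero, sub_zero, norm_smul, htn, inv_mul_le_iff₀ ht0]
    -- The trajectory never leaves the ball of radius `‖x‖`, so its speed is at most `A ‖x‖`.
    have := norm_image_sub_le_of_norm_deriv_right_le_segment (f := fun t => φ t x)
      (f' := fun t => h (φ t x)) (C := A * ‖x‖) (a := 0) (b := t)
      (fun t ht => (((hφ t ht.1).2 x hx).2.2.continuousWithinAt).mono Icc_subset_Ici_self)
      (fun t ht => (((hφ t ht.1).2 x hx).2.2).mono (Ici_subset_Ici.2 ht.1))
      (fun t ht => ?_) t (right_mem_Icc.2 ht0.le)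
    · simp only [((hφ 0 le_rfl).2 x hx).1, sub_zero] at this
      linarith
    · have h3 := ((hφ t ht.1).2 x hx).2.1
      refine (hAδ _ ?_).trans (mul_le_mul_of_nonneg_left h3 hA0)
      rw [mem_ball_zero_iff] at hxδ ⊢
      exact h3.trans_lt hxδ
  exact norm_le_of_numericalRange_le (hHd.mono (ball_subset_ball hs1.le))
    (fun x hx => hHb x (ball_subset_ball hs1.le hx))
    (fun y hy ℓ hℓ hℓy => hHdis.norm_apply_le hHd hH0 hHA hs1 (mem_ball_zero_iff.1 hy).le hℓ hℓy)
    (by linarith) hrs hτ hτK hτρ (mem_ball_zero_iff.1 hw).le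

end Dissipative

/-! ### The domain `Ω` and the resolvent -/

section Resolvent

open Filter Topology ComplexConjugate

/-- On the disc, `Re μ ≥ -|μ|` leaves `(1 - r²) - 2(1 + r)²|μ|`. On the sector, `cos (arg μ) > 2r /
(1 + r²)` makes the first two terms positive together. -/
theorem pos_of_mem_keyDomain {r : ℝ} (hr0 : 0 < r) (hr1 : r < 1) {μ : ℂ} (hμ : μ ∈ keyDomain r) :
    0 < 2 * (1 + r ^ 2) * μ.re - 4 * r * ‖μ‖ + (1 - r ^ 2) := by
  have hr2 : 0 < 1 + r := by linarith
  have hr3 : 0 < 1 - r := by linarith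
  rcases hμ with hμ | ⟨hμ0, hμ⟩
  · have h1 : ‖μ‖ < 1 / 2 * ((1 - r) / (1 + r)) := hμ
    have h2 : 2 * (1 + r) * ‖μ‖ < 1 - r := by
      calc 2 * (1 + r) * ‖μ‖ < 2 * (1 + r) * (1 / 2 * ((1 - r) / (1 + r))) := by gcongr
        _ = 1 - r := by field_simp
    have h3 : -‖μ‖ ≤ μ.re := (abs_le.1 (Complex.abs_re_le_norm μ)).1
    have h4 : 2 * (1 + r ^ 2) * -‖μ‖ ≤ 2 * (1 + r ^ 2) * μ.re := by gcongr
    nlinarith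
  · have hpos := norm_pos_iff.2 hμ0
    have h1 : Real.cos (Real.arcsin ((1 - r ^ 2) / (1 + r ^ 2))) < Real.cos |μ.arg| := by
      refine Real.cos_lt_cos_of_nonneg_of_le_pi (abs_nonneg _) ?_ hμ
      linarith [Real.arcsin_le_pi_div_two ((1 - r ^ 2) / (1 + r ^ 2)), Real.pi_pos]
    rw [Real.cos_abs, Complex.cos_arg hμ0, Real.cos_arcsin,
      show 1 - ((1 - r ^ 2) / (1 + r ^ 2)) ^ 2 = (2 * r / (1 + r ^ 2)) ^ 2 by
        field_simp; ring, Real.sqrt_sq (by positivity), div_lt_div_iff₀ (by positivity) hpos] at h1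
    nlinarith

/-- Squaring and using `C² - R² = 1` reduces the inequality to `pos_of_mem_keyDomain` with `s` for
`r`, an open condition in `s`. -/
theorem exists_radius_of_mem_keyDomain {r : ℝ} (hr0 : 0 < r) (hr1 : r < 1) {μ : ℂ}
    (hμ : μ ∈ keyDomain r) : ∃ s, r < s ∧ s < 1 ∧
      ‖μ‖ + 2 * s / (1 - s ^ 2) < ‖μ + ((1 + s ^ 2) / (1 - s ^ 2) : ℝ)‖ := by
  have h1 : ∀ᶠ s : ℝ in 𝓝[>] r, 0 < 2 * (1 + s ^ 2) * μ.re - 4 * s * ‖μ‖ + (1 - s ^ 2) :=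
    nhdsWithin_le_nhds (ContinuousAt.eventually_lt (by fun_prop) (by fun_prop)
      (pos_of_mem_keyDomain hr0 hr1 hμ))
  have h2 : ∀ᶠ s : ℝ in 𝓝[>] r, s < 1 := nhdsWithin_le_nhds (eventually_lt_nhds hr1)
  obtain ⟨s, ⟨h1, hs1⟩, hs⟩ := ((h1.and h2).and self_mem_nhdsWithin).exists
  have hrs : r < s := hs
  have hs0 : 0 < s := hr0.trans hrs
  have hpos : 0 < 1 - s ^ 2 := by nlinarith
  refine ⟨s, hrs, hs1, lt_of_pow_lt_pow_left₀ 2 (norm_nonneg _) ?_⟩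
  set C := (1 + s ^ 2) / (1 - s ^ 2) with hC
  set R := 2 * s / (1 - s ^ 2) with hR
  have hCR : C ^ 2 - R ^ 2 = 1 := by rw [hC, hR]; field_simp; ring
  have h3 : 0 < 2 * C * μ.re - 2 * R * ‖μ‖ + 1 := by
    have : 2 * C * μ.re - 2 * R * ‖μ‖ + 1 =
        (2 * (1 + s ^ 2) * μ.re - 4 * s * ‖μ‖ + (1 - s ^ 2)) / (1 - s ^ 2) := by
      rw [hC, hR]; field_simp; ring
    rw [this]; positivity
  have h4 : ‖μ + (C : ℂ)‖ ^ 2 = ‖μ‖ ^ 2 + 2 * C * μ.re + C ^ 2 := by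
    rw [Complex.sq_norm, Complex.sq_norm, Complex.normSq_apply, Complex.normSq_apply]
    simp only [Complex.add_re, Complex.add_im, Complex.ofReal_re, Complex.ofReal_im]
    ring
  rw [h4]
  nlinarith

/-- The Apollonius disc `|p + n| ≤ s |p - n|`, written with its Euclidean centre and radius. -/
theorem norm_add_mul_le_of_norm_add_le {p : ℂ} {n s : ℝ} (hn : 0 ≤ n) (hs0 : 0 < s) (hs1 : s < 1)
    (h : ‖p + n‖ ≤ s * ‖p - n‖) :
    ‖p + ((1 + s ^ 2) / (1 - s ^ 2) : ℝ) * n‖ ≤ 2 * s / (1 - s ^ 2) * n := by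
  have hpos : 0 < 1 - s ^ 2 := by nlinarith
  have h1 : ‖p + n‖ ^ 2 ≤ s ^ 2 * ‖p - n‖ ^ 2 := by
    rw [← mul_pow]; gcongr
  refine le_of_sq_le_sq ?_ (by positivity)
  set C := (1 + s ^ 2) / (1 - s ^ 2) with hC
  set R := 2 * s / (1 - s ^ 2) with hR
  have hCR : R ^ 2 = C ^ 2 - 1 := by rw [hC, hR]; field_simp; ring
  have hCs : C * (1 - s ^ 2) = 1 + s ^ 2 := by rw [hC]; field_simp
  rw [mul_pow, hCR]
  rw [Complex.sq_norm, Complex.sq_norm, Complex.normSq_apply, Complex.normSq_apply] at h1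
  rw [Complex.sq_norm, Complex.normSq_apply]
  simp only [Complex.add_re, Complex.add_im, Complex.sub_re, Complex.sub_im, Complex.ofReal_re,
    Complex.ofReal_im, Complex.re_ofReal_mul, Complex.im_ofReal_mul] at h1 ⊢
  refine le_of_mul_le_mul_right ?_ hpos
  have h2 : (p.re * p.re + p.im * p.im + n ^ 2) * (1 - s ^ 2) +
      2 * p.re * n * (1 + s ^ 2) ≤ 0 := by linarith
  rw [← hCs] at h2
  linarith

variable {X : Type*} [NormedAddCommGroup X] [NormedSpace ℂ X] [CompleteSpace X] {h : X → X}

theorem exists_local_resolvent (hol : DifferentiableOn ℂ h (ball 0 1))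
    (hsc : IsSemiComplete h (ball 0 1)) (h0 : h 0 = 0)
    (hd : HasFDerivAt h (-(ContinuousLinearMap.id ℂ X)) 0) {r : ℝ} (hr0 : 0 < r) (hr1 : r < 1)
    {μ : ℂ} (hμ : μ ∈ keyDomain r) :
    ∃ c, ‖μ‖ < c ∧ ∀ z ∈ ball (0 : X) (c * r), ∃ W : Set (ℂ × X), IsOpen W ∧ (μ, z) ∈ W ∧
      ∃ x : ℂ × X → X, DifferentiableOn ℂ x W ∧ ∀ p ∈ W, x p ∈ ball (0 : X) r ∧
        p.1 • x p - h (x p) = p.2 ∧ ∀ y ∈ ball (0 : X) r, p.1 • y - h y = p.2 → y = x p := by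
  obtain ⟨s, hrs, hs1, hs⟩ := exists_radius_of_mem_keyDomain hr0 hr1 hμ
  have hs0 : 0 < s := hr0.trans hrs
  have hdis := hsc.isDissipativeOn hol h0
  obtain ⟨M, hM⟩ := hsc.exists_norm_le hol h0 hs0 hs1
  set C := (1 + s ^ 2) / (1 - s ^ 2)
  set R := 2 * s / (1 - s ^ 2)
  set ν := μ + (C : ℂ)
  have hc : ‖μ‖ < ‖ν‖ - R := by linarith
  have hR : 0 < R := div_pos (by linarith) (by nlinarith)
  have hν : 0 < ‖ν‖ := by linarith [norm_nonneg μ]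
  have hνC : (‖ν‖ : ℂ) ≠ 0 := by exact_mod_cast hν.ne'
  refine ⟨‖ν‖ - R, hc, fun z hz => ?_⟩
  rw [mem_ball_zero_iff] at hz
  obtain ⟨b, hzb, hb⟩ := exists_between hz
  -- `η` is the room left for varying `μ`, which gives holomorphy jointly in `(μ, z)`.
  obtain ⟨η, hη, hη1, hη2⟩ : ∃ η : ℝ, 0 < η ∧ 0 < ‖ν‖ - R - η ∧ b < (‖ν‖ - R - η) * r := by
    have h1 : ∀ᶠ η : ℝ in 𝓝[>] 0, 0 < ‖ν‖ - R - η := nhdsWithin_le_nhds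
      (ContinuousAt.eventually_lt (by fun_prop) (by fun_prop) (by linarith [norm_nonneg μ]))
    have h2 : ∀ᶠ η : ℝ in 𝓝[>] 0, b < (‖ν‖ - R - η) * r := nhdsWithin_le_nhds
      (ContinuousAt.eventually_lt (by fun_prop) (by fun_prop) (by simpa))
    obtain ⟨η, ⟨h1, h2⟩, h3⟩ := ((h1.and h2).and self_mem_nhdsWithin).exists
    exact ⟨η, h3, h1, h2⟩
  -- Multiplying by `e` keeps the zeros of the field and turns `ν` into `‖ν‖`.
  set e : ℂ := conj ν / ‖ν‖ with he
  have hen : ‖e‖ = 1 := by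
    rw [he, norm_div, Complex.norm_conj, Complex.norm_real, norm_norm, div_self hν.ne']
  have he0 : e ≠ 0 := norm_pos_iff.1 (by rw [hen]; exact one_pos)
  have heν : e * ν = ‖ν‖ := by
    rw [he, div_mul_eq_mul_div, mul_comm, Complex.mul_conj, Complex.normSq_eq_norm_sq,
      Complex.ofReal_pow, sq, mul_div_cancel_right₀ _ hνC]
  have hre : ∀ w, (e * w).re ≤ ‖w‖ := fun w =>
    (Complex.re_le_norm _).trans (by rw [norm_mul, hen, one_mul])
  have hW : IsOpen (ball μ η ×ˢ ball (0 : X) b) := isOpen_ball.prod isOpen_ball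
  refine ⟨ball μ η ×ˢ ball (0 : X) b, hW, ⟨mem_ball_self hη, mem_ball_zero_iff.2 hzb⟩, ?_⟩
  have hFd : DifferentiableOn ℂ (fun q : (ℂ × X) × X => e • (q.1.2 + h q.2 - q.1.1 • q.2))
      ((ball μ η ×ˢ ball (0 : X) b) ×ˢ ball 0 s) := by
    have hh : DifferentiableOn ℂ (fun q : (ℂ × X) × X => h q.2)
        ((ball μ η ×ˢ ball (0 : X) b) ×ˢ ball 0 s) :=
      hol.comp differentiableOn_snd fun q hq => ball_subset_ball hs1.le hq.2
    refine DifferentiableOn.const_smul (DifferentiableOn.sub (DifferentiableOn.add ?_ hh) ?_) _ <;>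
    fun_prop
  have hNF : ∀ p ∈ ball μ η ×ˢ ball (0 : X) b, ∀ y ∈ ball (0 : X) s,
      ‖e • (p.2 + h y - p.1 • y)‖ ≤ b + M + (‖μ‖ + η) * s := by
    rintro ⟨l, w⟩ ⟨hl, hw⟩ y hy
    have h1 := hM y hy
    simp only [mem_ball_zero_iff] at hw hy
    rw [mem_ball, dist_eq_norm] at hl
    rw [norm_smul, hen, one_mul]
    have h2 : ‖l‖ ≤ ‖μ‖ + η := by linarith [norm_le_norm_add_norm_sub' l μ]
    have h3 : ‖l • y‖ ≤ (‖μ‖ + η) * s := by rw [norm_smul]; gcongr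
    simp only
    linarith [norm_sub_le (w + h y) (l • y), norm_add_le w (h y)]
  have hF : ∀ p ∈ ball μ η ×ˢ ball (0 : X) b, ∀ y ∈ ball (0 : X) s, ∀ ℓ : StrongDual ℂ X,
      ‖ℓ‖ ≤ 1 → ℓ y = ‖y‖ →
      (ℓ (e • (p.2 + h y - p.1 • y))).re ≤ b - (‖ν‖ - R - η) * ‖y‖ := by
    rintro ⟨l, w⟩ ⟨hl, hw⟩ y hy ℓ hℓ hℓy
    simp only [mem_ball_zero_iff] at hw
    rw [mem_ball, dist_eq_norm] at hl
    have hy1 : y ∈ ball (0 : X) 1 := ball_subset_ball hs1.le hy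
    have hp : ‖ℓ (h y) + C * ‖y‖‖ ≤ R * ‖y‖ := by
      refine norm_add_mul_le_of_norm_add_le (norm_nonneg _) hs0 hs1 ?_
      rcases eq_or_ne y 0 with rfl | hy0
      · simp [h0]
      have hfd : ℓ (fderiv ℂ h 0 y) = -(‖y‖ : ℂ) := by rw [hd.fderiv]; simp [hℓy]
      have := hdis.norm_apply_sub_le hol h0 hy1 hℓ hℓy (by
        rw [hfd]; simpa using hy0)
      rw [hfd, sub_neg_eq_add, map_neg, Complex.conj_ofReal, ← sub_eq_add_neg] at this
      refine this.trans ?_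
      gcongr
      exact (mem_ball_zero_iff.1 hy).le
    have hsplit : ℓ (e • (w + h y - l • y)) = e * (ℓ (h y) + C * ‖y‖) + e * ℓ w -
        ‖y‖ * (e * ν) - ‖y‖ * (e * (l - μ)) := by
      simp only [map_smul, map_sub, map_add, smul_eq_mul, hℓy, ν]
      ring
    have h1 := (hre (ℓ (h y) + C * ‖y‖)).trans hp
    have h2 : (e * ℓ w).re ≤ ‖w‖ := (hre _).trans
      ((ℓ.le_opNorm w).trans (mul_le_of_le_one_left (norm_nonneg _) hℓ))
    have h3 : -(e * (l - μ)).re ≤ η := by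
      rw [← Complex.neg_re, ← mul_neg]
      refine (hre _).trans ?_
      rw [norm_neg]; exact hl.le
    simp only [hsplit, heν, Complex.sub_re, Complex.add_re, Complex.re_ofReal_mul,
      Complex.ofReal_re]
    nlinarith [mul_le_mul_of_nonneg_left h3 (norm_nonneg y)]
  obtain ⟨x, hxd, hx⟩ := exists_unique_zero_differentiableOn hW
    (F := fun (p : ℂ × X) x => e • (p.2 + h x - p.1 • x)) hr0 hrs hη1 hη2 hFd hNF hF
  have hiff : ∀ (p : ℂ × X) y, e • (p.2 + h y - p.1 • y) = 0 ↔ p.1 • y - h y = p.2 := by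
    intro p y
    rw [smul_eq_zero_iff_right he0, sub_eq_zero, sub_eq_iff_eq_add, eq_comm]
  refine ⟨x, hxd, fun p hp => ?_⟩
  obtain ⟨h1, h2, h3⟩ := hx p hp
  exact ⟨h1, (hiff _ _).1 h2, fun y hy hpy => h3 y hy ((hiff _ _).2 hpy)⟩

end Resolvent

theorem mainTheorem8 {X : Type*} [NormedAddCommGroup X] [NormedSpace ℂ X] [CompleteSpace X]
    (h : X → X) (hol : DifferentiableOn ℂ h (ball 0 1))
    (hsc : IsSemiComplete h (ball 0 1))
    (h0 : h 0 = 0) (hd : HasFDerivAt h (-(ContinuousLinearMap.id ℂ X)) 0)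
    (r : ℝ) (hr0 : 0 < r) (hr1 : r < 1) :
    (∀ μ ∈ keyDomain r,
      (∃ V : Set X, ResolventExistsOn h (ball 0 r) μ V ∧ ∀ y ∈ ball (0 : X) r, μ • y ∈ V) ∧
      MapsTo (associatedResolvent h (ball 0 r) μ) (ball 0 r) (ball 0 r)) ∧
    DifferentiableOn ℂ (fun p : ℂ × X => associatedResolvent h (ball 0 r) p.1 p.2)
      (keyDomain r ×ˢ ball 0 r) := by
  have hloc : ∀ μ ∈ keyDomain r, ∃ c, ‖μ‖ < c ∧ ∀ z ∈ ball (0 : X) (c * r),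
      (∃! x : X, x ∈ ball (0 : X) r ∧ μ • x - h x = z) ∧
      nonlinearResolvent h (ball 0 r) μ z ∈ ball (0 : X) r ∧
      DifferentiableAt ℂ (fun p : ℂ × X => nonlinearResolvent h (ball 0 r) p.1 p.2) (μ, z) := by
    intro μ hμ
    obtain ⟨c, hc, hcz⟩ := exists_local_resolvent hol hsc h0 hd hr0 hr1 hμ
    refine ⟨c, hc, fun z hz => ?_⟩
    obtain ⟨W, hW, hzW, x, hxd, hx⟩ := hcz z hz
    -- Uniqueness identifies the chosen inverse with the local holomorphic solution.
    have heq : ∀ p ∈ W, nonlinearResolvent h (ball 0 r) p.1 p.2 = x p := by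
      intro p hp
      have hex : ∃ a ∈ ball (0 : X) r, p.1 • a - h a = p.2 := ⟨x p, (hx p hp).1, (hx p hp).2.1⟩
      exact (hx p hp).2.2 _ (Function.invFunOn_mem hex) (Function.invFunOn_eq hex)
    obtain ⟨h1, h2, h3⟩ := hx _ hzW
    refine ⟨⟨_, ⟨h1, h2⟩, fun y hy => h3 y hy.1 hy.2⟩, ?_, ?_⟩
    · rw [heq _ hzW]; exact h1
    · refine (hxd.differentiableAt (hW.mem_nhds hzW)).congr_of_eventuallyEq ?_
      filter_upwards [hW.mem_nhds hzW] with p hp using heq p hp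
  have hsmul : ∀ {μ : ℂ} {c : ℝ}, ‖μ‖ < c → ∀ y ∈ ball (0 : X) r, μ • y ∈ ball (0 : X) (c * r) := by
    intro μ c hc y hy
    rw [mem_ball_zero_iff] at hy ⊢
    rw [norm_smul]
    exact mul_lt_mul'' hc hy (norm_nonneg _) (norm_nonneg _)
  refine ⟨fun μ hμ => ?_, ?_⟩
  · obtain ⟨c, hc, hcz⟩ := hloc μ hμ
    have hc0 : 0 < c := (norm_nonneg μ).trans_lt hc
    -- Since `‖μ‖ < c`, this ball contains `μ` times the ball of radius `r`, and it stays open and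
    -- nonempty even for `μ = 0`.
    refine ⟨⟨ball 0 (c * r), ⟨isOpen_ball, ?_, fun z hz => (hcz z hz).1, fun z hz => ?_⟩,
      hsmul hc⟩, fun y hy => (hcz _ (hsmul hc y hy)).2.1⟩
    · rw [h0, neg_zero]; exact mem_ball_self (by positivity)
    · exact (DifferentiableAt.comp (f := fun z : X => (μ, z)) z (hcz z hz).2.2
        (by fun_prop)).differentiableWithinAt
  · rintro ⟨μ, y⟩ ⟨hμ, hy⟩
    obtain ⟨c, hc, hcz⟩ := hloc μ hμ
    exact (DifferentiableAt.comp (f := fun p : ℂ × X => (p.1, p.1 • p.2)) (μ, y)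
      (hcz _ (hsmul hc y hy)).2.2 (by fun_prop)).differentiableWithinAt
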